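/- Let $(x,y,z,t)$ be coordinates on $\mathbb R^4$ and consider the two-component generalizations of the second heavenly equation, $$\mathcal E_{\mathrm{II}}:\quad \begin{cases} v_{ty}+v_{xz}+v_yv_{xx}-(v_x+w_y)v_{xy}+w_xv_{yy}=0,\\ w_{ty}+w_{xz}+v_yw_{xx}-(v_x+w_y)w_{xy}+w_xw_{yy}=0,\end{cases}$$ and of the first heavenly equation, $$\mathcal E_{\mathrm{I}}:\quad \begin{cases} v_xv_{ty}-v_yv_{tx}+w_xv_{yz}-w_yv_{xz}=0,\\ v_xw_{ty}-v_yw_{tx}+w_xw_{yz}-w_yw_{xz}=0,\end{cases}$$ together with their coverings, depending on a parameter $\lambda\in\mathbb R$, $$\tau^{\mathrm{II}}_\lambda:\ \begin{cases} q_t=(v_x-\lambda)q_x-w_xq_y,\\ q_z=-v_yq_x+(w_y+\lambda)q_y,\end{cases}\qquad \tau^{\mathrm{I}}_\lambda:\ \begin{cases} q_x=-\lambda(v_xq_t+w_xq_z),\\ q_y=-\lambda(v_yq_t+w_yq_z).\end{cases}$$ For a system $\mathcal E$, its infinite prolongation is the set $\mathcal E^\infty$ of infinite jets on which all its equations and all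 their total derivatives vanish; let $\tilde{\mathcal E}_\lambda^\infty$ be the infinite prolongation of the joint system for $(v,w,q)$ consisting of $\mathcal E$ and $\tau_\lambda$, projected to the jets of $(v,w)$ by forgetting $q$. For a transformation $g$ of the jets of $(v,w)$, we say that $g$ lifts locally to a map $\tilde{\mathcal E}_\lambda^\infty\to\tilde{\mathcal E}_\mu^\infty$ if there is a diffeomorphism, preserving the Cartan distributions, from a nonempty (relatively) open part of $\tilde{\mathcal E}_\lambda^\infty$ onto a (relatively) open part of $\tilde{\mathcal E}_\mu^\infty$ which covers $g$. The coverings $\tau_\lambda$ and $\tau_\mu$ are locally equivalent if the identity lifts locally in this sense. Then, for each of the two systems: 1. $\lambda$ is a non-removable parameter of the covering: for all real $\lambda\neq\mu$ the coverings $\tau_\lambda$ and $\tau_\mu$ are not (even locally) equivalent. 2. The scaling symmetries which act nontrivially on $\lambda$ do not lift to symmetries of the joint system. Precisely: (II) For all nonzero reals $a,b,d$ the scaling $(x,y,z,t,v,w)\mapsto(ax,\,by,\,\tfrac{db}{a}z,\,dt,\,\tfrac{a^2}{d}v,\,\tfrac{ab}{d}w)$ is a symmetry of $\mathcal E_{\mathrm{II}}$,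 i.e. its prolongation maps $\mathcal E_{\mathrm{II}}^\infty$ to itself; and if $a\ne d$ and $\lambda\neq0$, it does not lift locally to a map of $\tilde{\mathcal E}_\lambda^\infty$ to itself; in particular it does not lift to a contact symmetry of the joint system. (I) For all nonzero reals $a,b,e,d,c$ the scaling $(x,y,z,t,v,w)\mapsto(ax,\,by,\,ez,\,dt,\,cv,\,\tfrac{ce}{d}w)$ is a symmetry of $\mathcal E_{\mathrm{I}}$ in the same sense; and if $c\neq d$ and $\lambda\ne0$, it does not lift locally to a map of $\tilde{\mathcal E}_\lambda^\infty$ to itself; in particular it does not lift to a contact symmetry of the joint system. -/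

import Mathlib

open scoped ContDiff Topology

/-- Coordinates on the space of infinite jets of maps `ℝⁿ → ℝᵐ`: the independent variables,
and for each dependent variable `a` and multi-index `σ` the derivative `u^a_σ`. -/
abbrev JetCoord (n m : ℕ) : Type := Fin n ⊕ (Fin m × (Fin n → ℕ))

/-- The infinite jet space `J^∞(ℝⁿ, ℝᵐ)`, with the product (= inverse limit) topology. -/
abbrev Jet (n m : ℕ) : Type := JetCoord n m → ℝ

/-- The jet coordinate `u^a_{i₁ … i_k}` for a list `[i₁, …, i_k]` of independent variables;
it depends only on how often each variable occurs in the list. -/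
def jetD {n m : ℕ} (a : Fin m) (l : List (Fin n)) (θ : Jet n m) : ℝ :=
  θ (Sum.inr (a, fun i => l.count i))

/-- Smooth functions on the infinite jet space: smooth functions of finitely many coordinates. -/
def IsSmoothJetFun {n m : ℕ} (f : Jet n m → ℝ) : Prop :=
  ∃ (S : Finset (JetCoord n m)) (g : (S → ℝ) → ℝ),
    ContDiff ℝ ∞ g ∧ ∀ θ, f θ = g (fun c => θ c)

/-- The value at `θ` of the vector field
`D_i = ∂/∂x^i + ∑_{a,σ} u^a_{σ+1_i} ∂/∂u^a_σ`. These fields span the Cartan distribution. -/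
def cartanVec {n m : ℕ} (i : Fin n) (θ : Jet n m) : Jet n m
  | Sum.inl j => if j = i then 1 else 0
  | Sum.inr (a, σ) => θ (Sum.inr (a, σ + Pi.single i 1))

/-- The total derivative `D_i f`. -/
noncomputable def totalD {n m : ℕ} (i : Fin n) (f : Jet n m → ℝ) : Jet n m → ℝ :=
  fun θ => lineDeriv ℝ f θ (cartanVec i θ)

/-- The iterated total derivative `D_{i₁} ⋯ D_{i_k} f`. -/
noncomputable def totalDs {n m : ℕ} (l : List (Fin n)) (f : Jet n m → ℝ) : Jet n m → ℝ :=
  l.foldr totalD f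

/-- The infinite prolongation of the system `F_k = 0`: all equations and all their total
derivatives of all orders. -/
def prolongation {n m : ℕ} {ι : Type} (F : ι → Jet n m → ℝ) : Set (Jet n m) :=
  {θ | ∀ (k : ι) (l : List (Fin n)), totalDs l (F k) θ = 0}

/-- `Ψ`, defined on `E ∩ U`, is smooth, acts on the independent variables by `x^i ↦ s_i x^i`, and
preserves the Cartan distribution: near each point, `Ψ^* u^a` is given on `E` by a smooth function
`f_a`, and the relations `D_i ∘ Ψ^* = s_i Ψ^* ∘ D_i` determine `Ψ` on all derivatives of `u^a`. -/
def IsCartanMap {n m m' : ℕ} (s : Fin n → ℝ) (E U : Set (Jet n m))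
    (Ψ : Jet n m → Jet n m') : Prop :=
  ∀ θ ∈ E ∩ U, ∃ f : Fin m' → Jet n m → ℝ, (∀ a, IsSmoothJetFun (f a)) ∧
    ∀ᶠ θ' in 𝓝[E] θ,
      (∀ i, Ψ θ' (Sum.inl i) = s i * θ' (Sum.inl i)) ∧
      ∀ (a : Fin m') (l : List (Fin n)),
        (l.map s).prod * jetD a l (Ψ θ') = totalDs l (f a) θ'

/-- The projection forgetting the last dependent variable, `(v, w, q) ↦ (v, w)`. -/
def forgetLast {n m : ℕ} (θ : Jet n (m + 1)) : Jet n m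
  | Sum.inl i => θ (Sum.inl i)
  | Sum.inr (a, σ) => θ (Sum.inr (a.castSucc, σ))

/-- The transformation `g` of the jets of `(v, w)`, acting on the independent variables by
`x^i ↦ s_i x^i`, is covered, locally somewhere, by a diffeomorphism from (an open part of) `E` to
(an open part of) `E'` which preserves the Cartan distributions. -/
def LiftsLocally {n m : ℕ} (s : Fin n → ℝ) (g : Jet n m → Jet n m)
    (E E' : Set (Jet n (m + 1))) : Prop :=
  ∃ (U U' : Set (Jet n (m + 1))) (Ψ Φ : Jet n (m + 1) → Jet n (m + 1)),
    IsOpen U ∧ IsOpen U' ∧ (E ∩ U).Nonempty ∧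
    Set.MapsTo Ψ (E ∩ U) (E' ∩ U') ∧ Set.MapsTo Φ (E' ∩ U') (E ∩ U) ∧
    Set.LeftInvOn Φ Ψ (E ∩ U) ∧ Set.RightInvOn Φ Ψ (E' ∩ U') ∧
    IsCartanMap s E U Ψ ∧ IsCartanMap s⁻¹ E' U' Φ ∧
    ∀ θ ∈ E ∩ U, forgetLast (Ψ θ) = g (forgetLast θ)

/-- Two coverings of the same system, with one fibre variable `q`, are locally equivalent:
some open parts of them are related by a diffeomorphism over the identity of the base
which preserves the Cartan distributions. -/
def CoveringsLocallyEquivalent {n m : ℕ} (E E' : Set (Jet n (m + 1))) : Prop :=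
  LiftsLocally 1 id E E'

/-- The parameter of a family of coverings is non-removable: coverings with different values of
the parameter are not equivalent, not even locally. -/
def IsNonremovable {n m : ℕ} (E : ℝ → Set (Jet n (m + 1))) : Prop :=
  ∀ lam mu : ℝ, lam ≠ mu → ¬ CoveringsLocallyEquivalent (E lam) (E mu)

/-- The prolongation to infinite jets of the scaling `x^i ↦ s_i x^i`, `u^a ↦ c_a u^a`. -/
noncomputable def scaling {n m : ℕ} (s : Fin n → ℝ) (c : Fin m → ℝ) (θ : Jet n m) : Jet n m
  | Sum.inl i => s i * θ (Sum.inl i)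
  | Sum.inr (a, σ) => c a / (∏ i, s i ^ σ i) * θ (Sum.inr (a, σ))

namespace Heavenly

/-! Independent variables `(x, y, z, t)`, dependent variables `(v, w)` and `q`. -/

abbrev x : Fin 4 := 0
abbrev y : Fin 4 := 1
abbrev z : Fin 4 := 2
abbrev t : Fin 4 := 3

/-- The derivatives of `v`, on jets of `(v, w)`. -/
def v (l : List (Fin 4)) (θ : Jet 4 2) : ℝ := jetD 0 l θ
/-- The derivatives of `w`, on jets of `(v, w)`. -/
def w (l : List (Fin 4)) (θ : Jet 4 2) : ℝ := jetD 1 l θ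
/-- The derivatives of `q`, on jets of `(v, w, q)`. -/
def q (l : List (Fin 4)) (θ : Jet 4 3) : ℝ := jetD 2 l θ
/-- The derivatives of `v`, on jets of `(v, w, q)`. -/
def v' (l : List (Fin 4)) (θ : Jet 4 3) : ℝ := jetD 0 l θ
/-- The derivatives of `w`, on jets of `(v, w, q)`. -/
def w' (l : List (Fin 4)) (θ : Jet 4 3) : ℝ := jetD 1 l θ

/-- The two-component generalization of the second heavenly equation. -/
def secondEq : Fin 2 → Jet 4 2 → ℝ := ![
  fun θ => v [t, y] θ + v [x, z] θ + v [y] θ * v [x, x] θ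
    - (v [x] θ + w [y] θ) * v [x, y] θ + w [x] θ * v [y, y] θ,
  fun θ => w [t, y] θ + w [x, z] θ + v [y] θ * w [x, x] θ
    - (v [x] θ + w [y] θ) * w [x, y] θ + w [x] θ * w [y, y] θ]

/-- Its covering `q_t = (v_x - λ) q_x - w_x q_y`, `q_z = - v_y q_x + (w_y + λ) q_y`. -/
def secondCov (lam : ℝ) : Fin 2 → Jet 4 3 → ℝ := ![
  fun θ => q [t] θ - ((v' [x] θ - lam) * q [x] θ - w' [x] θ * q [y] θ),
  fun θ => q [z] θ - (- v' [y] θ * q [x] θ + (w' [y] θ + lam) * q [y] θ)]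

/-- The two-component generalization of the first heavenly equation. -/
def firstEq : Fin 2 → Jet 4 2 → ℝ := ![
  fun θ => v [x] θ * v [t, y] θ - v [y] θ * v [t, x] θ
    + w [x] θ * v [y, z] θ - w [y] θ * v [x, z] θ,
  fun θ => v [x] θ * w [t, y] θ - v [y] θ * w [t, x] θ
    + w [x] θ * w [y, z] θ - w [y] θ * w [x, z] θ]

/-- Its covering `q_x = - λ (v_x q_t + w_x q_z)`, `q_y = - λ (v_y q_t + w_y q_z)`. -/
def firstCov (lam : ℝ) : Fin 2 → Jet 4 3 → ℝ := ![
  fun θ => q [x] θ - (- lam * (v' [x] θ * q [t] θ + w' [x] θ * q [z] θ)),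
  fun θ => q [y] θ - (- lam * (v' [y] θ * q [t] θ + w' [y] θ * q [z] θ))]

/-- The joint system for `(v, w, q)`, prolonged: the total space of the covering. -/
def joint (F : Fin 2 → Jet 4 2 → ℝ) (G : ℝ → Fin 2 → Jet 4 3 → ℝ) (lam : ℝ) : Set (Jet 4 3) :=
  prolongation (Sum.elim (fun k θ => F k (forgetLast θ)) (G lam))

end Heavenly

/-! The obstruction is a loss of injectivity: the fibre component f of a lift (the pullback of q)
cannot change when a constant is added to q, so two distinct jets have the same image.

Points of a prolongation are formal solutions (`mem_prolongation_iff`), so the argument runs in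
formal power series. After undoing the scaling, which acts on the joint systems by changing λ, a
lift sends solutions q of the λ-covering over a pair (V, W) to solutions of the covering with
another parameter λ' over the same pair. Non-removability is the case of the identity scaling.

Fix (V, W). The covering says that q is killed by two derivations, so its solutions form a ring L
containing the constants. The linearization T of f in q is a differential operator of finite order
(`exists_linearization`), and it maps L into the kernel of the derivations A of the λ'-covering. For
φ in L, A([T, φ]ψ) = -A(φ) T(ψ), and iterated commutators with φ eventually vanish. If A(φ) ≠ 0 for
some φ in L and one of the two derivations A, descending induction on the number of commutators
gives T = 0 on L (`eq_zero_of_adMul_nilpotent`). Then T(1) = 0, which is the claimed invariance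
(`not_liftsLocally_scaling`).

A suitable φ comes from a formal Frobenius theorem (`exists_first_integral`): the two derivations of
the covering commute because (V, W) solves the heavenly system. For the first system the choice
fails where V and W do not depend on x and y, since there all coverings coincide; such a jet is
first moved to a nearby one with V_x ≠ 0 (`tilt`). -/

open MvPowerSeries in
/-- The Taylor coefficient `∂^σ r (0)` of a formal power series. -/
noncomputable def derivCoeff {n : ℕ} (σ : Fin n → ℕ) (r : MvPowerSeries (Fin n) ℝ) : ℝ :=
  (∏ i, ((σ i).factorial : ℝ)) * coeff (Finsupp.equivFunOnFinite.symm σ) r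

/-- The formal power series with given derivatives at the origin. -/
noncomputable def taylor {n : ℕ} (c : (Fin n → ℕ) → ℝ) : MvPowerSeries (Fin n) ℝ :=
  fun σ => c σ / ∏ i, ((σ i).factorial : ℝ)

/-! ### Formal power series and their derivatives at the origin -/

section Series

open MvPowerSeries

variable {n : ℕ}

lemma prod_factorial_ne_zero (σ : Fin n → ℕ) : (∏ i, ((σ i).factorial : ℝ)) ≠ 0 :=
  Finset.prod_ne_zero_iff.2 fun i _ => by exact_mod_cast (σ i).factorial_ne_zero

lemma derivCoeff_taylor (c : (Fin n → ℕ) → ℝ) (σ : Fin n → ℕ) :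
    derivCoeff σ (taylor c) = c σ := by
  have h := prod_factorial_ne_zero σ
  change (∏ i, ((σ i).factorial : ℝ)) * (c σ / ∏ i, ((σ i).factorial : ℝ)) = c σ
  field_simp

lemma ext_derivCoeff {r s : MvPowerSeries (Fin n) ℝ}
    (h : ∀ σ, derivCoeff σ r = derivCoeff σ s) : r = s := by
  ext σ
  have h1 := mul_left_cancel₀ (prod_factorial_ne_zero (⇑σ)) (h σ)
  simpa using h1

lemma derivCoeff_add (σ : Fin n → ℕ) (r s : MvPowerSeries (Fin n) ℝ) :
    derivCoeff σ (r + s) = derivCoeff σ r + derivCoeff σ s := by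
  simp [derivCoeff, mul_add]

lemma derivCoeff_smul (σ : Fin n → ℕ) (a : ℝ) (r : MvPowerSeries (Fin n) ℝ) :
    derivCoeff σ (a • r) = a * derivCoeff σ r := by
  simp [derivCoeff, mul_left_comm]

lemma derivCoeff_zero_right (σ : Fin n → ℕ) :
    derivCoeff σ (0 : MvPowerSeries (Fin n) ℝ) = 0 := by
  simp [derivCoeff]

lemma derivCoeff_zero (r : MvPowerSeries (Fin n) ℝ) : derivCoeff 0 r = constantCoeff r := by
  have : Finsupp.equivFunOnFinite.symm (0 : Fin n → ℕ) = 0 := by ext; simp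
  simp [derivCoeff, this]

/-- The factorial normalization absorbs the factor σ i + 1, so differentiation is a pure shift of
multi-indices, as for the total derivatives of jet coordinates. -/
lemma derivCoeff_pderiv (σ : Fin n → ℕ) (i : Fin n) (r : MvPowerSeries (Fin n) ℝ) :
    derivCoeff σ (pderiv ℝ i r) = derivCoeff (σ + Pi.single i 1) r := by
  have h1 : Finsupp.equivFunOnFinite.symm (σ + Pi.single i 1)
      = Finsupp.equivFunOnFinite.symm σ + Finsupp.single i 1 := by
    ext j
    simp [Finsupp.single_apply, Pi.single_apply, eq_comm]
  have h2 : (∏ j, (((σ + Pi.single i 1 : Fin n → ℕ) j).factorial : ℝ))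
      = (∏ j, ((σ j).factorial : ℝ)) * (σ i + 1) := by
    rw [← Finset.mul_prod_erase _ _ (Finset.mem_univ i),
      ← Finset.mul_prod_erase _ (fun j => ((σ j).factorial : ℝ)) (Finset.mem_univ i)]
    have : ∏ j ∈ Finset.univ.erase i, (((σ + Pi.single i 1 : Fin n → ℕ) j).factorial : ℝ)
        = ∏ j ∈ Finset.univ.erase i, ((σ j).factorial : ℝ) :=
      Finset.prod_congr rfl fun j hj => by simp [Finset.ne_of_mem_erase hj]
    rw [this]
    simp [Nat.factorial_succ]
    ring
  rw [derivCoeff, derivCoeff, coeff_pderiv, h1, h2]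
  simp
  ring

lemma pderiv_comm (i j : Fin n) (r : MvPowerSeries (Fin n) ℝ) :
    pderiv ℝ i (pderiv ℝ j r) = pderiv ℝ j (pderiv ℝ i r) :=
  ext_derivCoeff fun σ => by simp only [derivCoeff_pderiv, add_right_comm]

/-- Iterated formal partial derivatives. -/
noncomputable def pderivs (l : List (Fin n)) :
    Module.End ℝ (MvPowerSeries (Fin n) ℝ) :=
  l.foldr (fun i D => (pderiv ℝ i).toLinearMap ∘ₗ D) LinearMap.id

@[simp] lemma pderivs_nil (r : MvPowerSeries (Fin n) ℝ) : pderivs [] r = r := rfl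

@[simp] lemma pderivs_cons (i : Fin n) (l : List (Fin n)) (r : MvPowerSeries (Fin n) ℝ) :
    pderivs (i :: l) r = pderiv ℝ i (pderivs l r) := rfl

lemma pderivs_pderiv (i : Fin n) (l : List (Fin n)) (r : MvPowerSeries (Fin n) ℝ) :
    pderivs l (pderiv ℝ i r) = pderiv ℝ i (pderivs l r) := by
  induction l with
  | nil => rfl
  | cons j l ih => rw [pderivs_cons, ih, pderiv_comm, pderivs_cons]

lemma count_cons_eq (i : Fin n) (l : List (Fin n)) :
    (fun j => (i :: l).count j) = (fun j => l.count j) + Pi.single i 1 := by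
  funext j
  by_cases h : i = j
  · subst h; simp
  · simp [h, Ne.symm h]

lemma derivCoeff_pderivs (σ : Fin n → ℕ) (l : List (Fin n)) (r : MvPowerSeries (Fin n) ℝ) :
    derivCoeff σ (pderivs l r) = derivCoeff (σ + fun i => l.count i) r := by
  induction l generalizing σ with
  | nil => simp only [pderivs_nil, List.count_nil]; rfl
  | cons i l ih =>
    rw [pderivs_cons, derivCoeff_pderiv, ih, count_cons_eq, add_assoc, add_comm (Pi.single i 1)]

lemma constantCoeff_pderivs (l : List (Fin n)) (r : MvPowerSeries (Fin n) ℝ) :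
    constantCoeff (pderivs l r) = derivCoeff (fun i => l.count i) r := by
  rw [← derivCoeff_zero, derivCoeff_pderivs, zero_add]

/-- The list of variables in increasing order with multiplicities `σ`. -/
def multiList (σ : Fin n → ℕ) : List (Fin n) :=
  (List.finRange n).flatMap fun i => List.replicate (σ i) i

lemma count_multiList (σ : Fin n → ℕ) : (fun i => (multiList σ).count i) = σ := by
  funext i
  rw [multiList, List.count_flatMap]
  have : (List.count i ∘ fun j => List.replicate (σ j) j) = fun j => if j = i then σ j else 0 := by
    funext j; simp [List.count_replicate]
  rw [this, ← List.ofFn_id, List.map_ofFn, List.sum_ofFn]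
  simp

lemma ext_pderivs {r s : MvPowerSeries (Fin n) ℝ}
    (h : ∀ l, constantCoeff (pderivs l r) = constantCoeff (pderivs l s)) : r = s :=
  ext_derivCoeff fun σ => by
    simpa only [constantCoeff_pderivs, count_multiList] using h (multiList σ)

/-! ### Differential operators -/

/-- The commutator of an endomorphism with multiplication by `φ`. -/
noncomputable def adMul {R : Type*} [CommRing R] [Algebra ℝ R] (φ : R) :
    Module.End ℝ (Module.End ℝ R) :=
  LinearMap.mulRight ℝ (LinearMap.mulLeft ℝ φ) - LinearMap.mulLeft ℝ (LinearMap.mulLeft ℝ φ)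

section ad

variable {R : Type*} [CommRing R] [Algebra ℝ R]

lemma adMul_apply (φ : R) (X : Module.End ℝ R) (ψ : R) :
    adMul φ X ψ = X (φ * ψ) - φ * X ψ := rfl

lemma adMul_pow_mulLeft (φ a : R) (X : Module.End ℝ R) (k : ℕ) :
    (adMul φ ^ k) (LinearMap.mulLeft ℝ a * X) = LinearMap.mulLeft ℝ a * (adMul φ ^ k) X := by
  induction k with
  | zero => rfl
  | succ k ih =>
    rw [pow_succ', Module.End.mul_apply, ih, Module.End.mul_apply]
    ext ψ
    simp only [adMul_apply, Module.End.mul_apply, LinearMap.mulLeft_apply]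
    ring

/-- The Leibniz rule gives [D X, φ] = D(φ) X + D [X, φ]. The first term dies under the remaining
commutators, which are linear over multiplications; the second is covered by induction on k. -/
lemma adMul_pow_derivation (φ : R) (D : Derivation ℝ R R) (X : Module.End ℝ R) (k : ℕ)
    (h : (adMul φ ^ k) X = 0) :
    (adMul φ ^ (k + 1)) (D.toLinearMap * X) = 0 := by
  induction k generalizing X with
  | zero =>
    have : X = 0 := h
    simp [this]
  | succ k ih =>
    have h1 : adMul φ (D.toLinearMap * X)
        = LinearMap.mulLeft ℝ (D φ) * X + D.toLinearMap * adMul φ X := by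
      ext ψ
      simp only [adMul_apply, Module.End.mul_apply, LinearMap.add_apply,
        LinearMap.mulLeft_apply, Derivation.coeFn_coe, map_sub,
        Derivation.leibniz, smul_eq_mul]
      ring
    rw [pow_succ, Module.End.mul_apply, h1, map_add, adMul_pow_mulLeft, h, mul_zero, zero_add]
    exact ih _ (by rw [← Module.End.mul_apply, ← pow_succ, h])

lemma adMul_pow_of_le {φ : R} {X : Module.End ℝ R} {k m : ℕ} (hkm : k ≤ m)
    (h : (adMul φ ^ k) X = 0) : (adMul φ ^ m) X = 0 := by
  obtain ⟨j, rfl⟩ := Nat.exists_eq_add_of_le hkm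
  rw [add_comm, pow_add, Module.End.mul_apply, h, map_zero]

/-- A differential operator mapping a ring `L` of functions to constants of the derivation `A`
vanishes on `L` if `L` contains a non-constant of `A`. -/
theorem eq_zero_of_adMul_nilpotent [NoZeroDivisors R] {L : Set R} {φ : R}
    (hL : ∀ ψ ∈ L, φ * ψ ∈ L) (A : Derivation ℝ R R) (hφ : A φ ≠ 0) (X : Module.End ℝ R)
    (hX : ∀ ψ ∈ L, A (X ψ) = 0) (k : ℕ) (hk : (adMul φ ^ k) X = 0) :
    ∀ ψ ∈ L, X ψ = 0 := by
  have : Nontrivial R := ⟨⟨_, _, hφ⟩⟩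
  have : CharZero R := charZero_of_injective_algebraMap (algebraMap ℝ R).injective
  -- For k = 0, both X (φ ψ) and X ψ are killed by A, so only -A(φ) X ψ survives. Each further
  -- commutator adds one more copy of this term.
  have key : ∀ k : ℕ, ∀ ψ ∈ L, A ((adMul φ ^ (k + 1)) X ψ)
      = -((k + 1 : ℕ) : R) * A φ * (adMul φ ^ k) X ψ := by
    intro k
    induction k with
    | zero =>
      intro ψ hψ
      simp [adMul_apply, hX _ (hL ψ hψ), hX ψ hψ, mul_comm]
    | succ k ih =>
      intro ψ hψ
      rw [pow_succ', Module.End.mul_apply, adMul_apply, map_sub, Derivation.leibniz,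
        ih _ (hL ψ hψ), ih ψ hψ]
      conv_rhs => rw [pow_succ', Module.End.mul_apply, adMul_apply]
      simp only [smul_eq_mul]
      push_cast
      have : (adMul φ ^ (k + 1)) X ψ = (adMul φ ^ k) X (φ * ψ) - φ * (adMul φ ^ k) X ψ := by
        rw [pow_succ', Module.End.mul_apply, adMul_apply]
      rw [this]
      ring
  -- By `key`, vanishing of the (k+1)-st commutator on L forces vanishing of the k-th, as k + 1 and
  -- A φ are not zero divisors.
  have desc : ∀ k : ℕ, (∀ ψ ∈ L, (adMul φ ^ k) X ψ = 0) → ∀ ψ ∈ L, X ψ = 0 := by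
    intro k
    induction k with
    | zero => exact id
    | succ k ih =>
      intro h
      refine ih fun ψ hψ => ?_
      have h1 := key k ψ hψ
      rw [h ψ hψ, map_zero] at h1
      have h2 : ((k + 1 : ℕ) : R) ≠ 0 := Nat.cast_ne_zero.2 k.succ_ne_zero
      rcases mul_eq_zero.1 h1.symm with h3 | h3
      · rcases mul_eq_zero.1 h3 with h4 | h4
        · exact absurd (neg_eq_zero.1 h4) h2
        · exact absurd h4 hφ
      · exact h3
  exact desc k fun ψ _ => by rw [hk, LinearMap.zero_apply]

end ad

lemma adMul_pow_pderivs (φ a : MvPowerSeries (Fin n) ℝ) (l : List (Fin n)) :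
    (adMul φ ^ (l.length + 1)) (LinearMap.mulLeft ℝ a * pderivs l) = 0 := by
  rw [adMul_pow_mulLeft]
  suffices h : (adMul φ ^ (l.length + 1)) (pderivs l) = 0 by rw [h, mul_zero]
  induction l with
  | nil =>
    ext1 ψ
    simp [adMul_apply]
  | cons i l ih => exact adMul_pow_derivation φ (pderiv ℝ i) (pderivs l) _ ih

/-- A finite sum of operators `a_c ∂^{l_c}` is nilpotent under commutators. -/
lemma exists_adMul_pow_sum {ι : Type*} (S : Finset ι) (a : ι → MvPowerSeries (Fin n) ℝ)
    (l : ι → List (Fin n)) (φ : MvPowerSeries (Fin n) ℝ) :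
    ∃ k, (adMul φ ^ k) (∑ c ∈ S, LinearMap.mulLeft ℝ (a c) * pderivs (l c)) = 0 := by
  refine ⟨S.sup fun c => (l c).length + 1, ?_⟩
  rw [map_sum]
  exact Finset.sum_eq_zero fun c hc =>
    adMul_pow_of_le (Finset.le_sup (f := fun c => (l c).length + 1) hc) (adMul_pow_pderivs φ _ _)

/-! ### Solving formal first order equations -/

/-- Formal integration with respect to the `i`-th variable. -/
noncomputable def integrate (i : Fin n) (r : MvPowerSeries (Fin n) ℝ) : MvPowerSeries (Fin n) ℝ :=
  fun σ => if σ i = 0 then 0 else coeff (σ - Finsupp.single i 1) r / σ i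

lemma coeff_integrate (i : Fin n) (r : MvPowerSeries (Fin n) ℝ) (σ : Fin n →₀ ℕ) :
    coeff σ (integrate i r) = if σ i = 0 then 0 else coeff (σ - Finsupp.single i 1) r / σ i := rfl

lemma pderiv_integrate (i : Fin n) (r : MvPowerSeries (Fin n) ℝ) :
    pderiv ℝ i (integrate i r) = r := by
  ext σ
  rw [coeff_pderiv, coeff_integrate]
  have : (σ i : ℝ) + 1 ≠ 0 := by positivity
  simp [this]

lemma X_pow_dvd_integrate (i : Fin n) {k : ℕ} {r : MvPowerSeries (Fin n) ℝ}
    (h : (X i : MvPowerSeries (Fin n) ℝ) ^ k ∣ r) : X i ^ (k + 1) ∣ integrate i r := by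
  rw [X_pow_dvd_iff] at h ⊢
  intro σ hσ
  rw [coeff_integrate]
  split_ifs with h0
  · rfl
  · rw [h _ (by simp; omega), zero_div]

lemma integrate_sub (i : Fin n) (r s : MvPowerSeries (Fin n) ℝ) :
    integrate i r - integrate i s = integrate i (r - s) := by
  ext σ
  simp only [map_sub, coeff_integrate]
  split_ifs <;> ring

lemma eq_zero_of_X_pow_dvd (i : Fin n) {r : MvPowerSeries (Fin n) ℝ}
    (h : ∀ k, (X i : MvPowerSeries (Fin n) ℝ) ^ k ∣ r) : r = 0 := by
  ext σ
  exact X_pow_dvd_iff.1 (h (σ i + 1)) σ (Nat.lt_succ_self _)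

lemma eq_integrate_of_X_dvd (i : Fin n) {r : MvPowerSeries (Fin n) ℝ} (h : X i ∣ r) :
    r = integrate i (pderiv ℝ i r) := by
  ext σ
  rw [coeff_integrate]
  split_ifs with h0
  · exact X_dvd_iff.1 h σ h0
  · have h1 : σ - Finsupp.single i 1 + Finsupp.single i 1 = σ :=
      tsub_add_cancel_of_le (Finsupp.single_le_iff.2 (Nat.one_le_iff_ne_zero.2 h0))
    have h2 : ((σ - Finsupp.single i 1 : Fin n →₀ ℕ) i : ℝ) + 1 = σ i := by
      have : (σ - Finsupp.single i 1 : Fin n →₀ ℕ) i + 1 = σ i := by simp; omega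
      exact_mod_cast this
    have h3 : (σ i : ℝ) ≠ 0 := by exact_mod_cast h0
    rw [coeff_pderiv, h1, h2]
    field_simp

section Picard

variable (i : Fin n) (W : Module.End ℝ (MvPowerSeries (Fin n) ℝ))
  (hW : ∀ k r, (X i : MvPowerSeries (Fin n) ℝ) ^ k ∣ r → X i ^ k ∣ W r)

-- Since r is minus the integral of W r, and W preserves divisibility by powers of `X i`, every pass
-- gains one power; so all powers divide r.
include hW in
lemma eq_zero_of_pderiv_add {r : MvPowerSeries (Fin n) ℝ} (h0 : X i ∣ r)
    (h : pderiv ℝ i r + W r = 0) : r = 0 := by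
  refine eq_zero_of_X_pow_dvd i fun k => ?_
  induction k with
  | zero => simp
  | succ k ih =>
    rw [eq_integrate_of_X_dvd i h0, eq_neg_of_add_eq_zero_left h]
    exact X_pow_dvd_integrate i ((dvd_neg).2 (hW k r ih))

-- Picard iteration for r = ∫ (s - W r), which converges in the `X i`-adic topology because
-- integration raises the divisibility by one.
include hW in
lemma exists_pderiv_add_eq (s : MvPowerSeries (Fin n) ℝ) :
    ∃ r, X i ∣ r ∧ pderiv ℝ i r + W r = s := by
  let u : ℕ → MvPowerSeries (Fin n) ℝ :=
    fun k => Nat.rec 0 (fun _ r => integrate i (s - W r)) k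
  have hu : ∀ k, u (k + 1) = integrate i (s - W (u k)) := fun _ => rfl
  have hstep : ∀ k, X i ^ k ∣ u (k + 1) - u k := by
    intro k
    induction k with
    | zero => simp
    | succ k ih =>
      rw [hu (k + 1), hu k, integrate_sub]
      refine X_pow_dvd_integrate i ?_
      have : s - W (u (k + 1)) - (s - W (u k)) = -W (u (k + 1) - u k) := by
        rw [map_sub]; ring
      rw [this, dvd_neg]
      exact hW k _ ih
  have hle : ∀ k m, k ≤ m → X i ^ k ∣ u m - u k := by
    intro k m hkm
    induction m, hkm using Nat.le_induction with
    | base => simp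
    | succ m hkm ih =>
      have : u (m + 1) - u k = (u (m + 1) - u m) + (u m - u k) := by ring
      rw [this]
      exact dvd_add ((pow_dvd_pow _ hkm).trans (hstep m)) ih
  -- The coefficient at σ no longer changes from the iterate σ i + 1 on, so it can be read off
  -- there.
  let r : MvPowerSeries (Fin n) ℝ := fun σ => coeff σ (u (σ i + 1))
  have hr : ∀ k, X i ^ k ∣ r - u k := by
    intro k
    rw [X_pow_dvd_iff]
    intro σ hσ
    have := X_pow_dvd_iff.1 (hle (σ i + 1) k hσ) σ (Nat.lt_succ_self _)
    rw [map_sub] at this ⊢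
    change coeff σ (u (σ i + 1)) - _ = 0
    linarith
  have hfix : r = integrate i (s - W r) := by
    rw [← sub_eq_zero]
    refine eq_zero_of_X_pow_dvd i fun k => ?_
    have h1 : r - integrate i (s - W r)
        = (r - u (k + 1)) + integrate i (W (r - u k)) := by
      have h2 := integrate_sub i (s - W (u k)) (s - W r)
      rw [sub_sub_sub_cancel_left] at h2
      rw [hu, map_sub, ← h2]
      ring
    rw [h1]
    exact dvd_add ((pow_dvd_pow _ k.le_succ).trans (hr _))
      ((pow_dvd_pow _ k.le_succ).trans (X_pow_dvd_integrate i (hW k _ (hr k))))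
  refine ⟨r, ?_, ?_⟩
  · rw [hfix]
    simpa using X_pow_dvd_integrate i (k := 0) (r := s - W r) (by simp)
  · have h : pderiv ℝ i r = s - W r := by
      conv_lhs => rw [hfix]
      exact pderiv_integrate i _
    rw [h]; ring

end Picard

lemma X_pow_dvd_pderiv {i j : Fin n} (h : j ≠ i) {k : ℕ} {r : MvPowerSeries (Fin n) ℝ}
    (hr : (X i : MvPowerSeries (Fin n) ℝ) ^ k ∣ r) : X i ^ k ∣ pderiv ℝ j r := by
  rw [X_pow_dvd_iff] at hr ⊢
  intro σ hσ
  rw [coeff_pderiv, hr _ (by simpa [Finsupp.single_apply, h] using hσ), zero_mul]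

/-- The derivation `∂_i + p₁ ∂_k + p₂ ∂_l`. -/
noncomputable def transport (i k l : Fin n) (p₁ p₂ : MvPowerSeries (Fin n) ℝ) :
    Derivation ℝ (MvPowerSeries (Fin n) ℝ) (MvPowerSeries (Fin n) ℝ) :=
  pderiv ℝ i + p₁ • pderiv ℝ k + p₂ • pderiv ℝ l

lemma transport_apply (i k l : Fin n) (p₁ p₂ r : MvPowerSeries (Fin n) ℝ) :
    transport i k l p₁ p₂ r = pderiv ℝ i r + p₁ * pderiv ℝ k r + p₂ * pderiv ℝ l r := rfl

lemma X_pow_dvd_transport {i j k l : Fin n} (hi : j ≠ i) (hk : k ≠ i) (hl : l ≠ i)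
    (p₁ p₂ : MvPowerSeries (Fin n) ℝ) {m : ℕ} {r : MvPowerSeries (Fin n) ℝ}
    (hr : (X i : MvPowerSeries (Fin n) ℝ) ^ m ∣ r) : X i ^ m ∣ transport j k l p₁ p₂ r :=
  dvd_add (dvd_add (X_pow_dvd_pderiv hi hr) ((X_pow_dvd_pderiv hk hr).mul_left _))
    ((X_pow_dvd_pderiv hl hr).mul_left _)

/-- Commuting derivations `∂_i + p₁ ∂_k + p₂ ∂_l` and `∂_j + r₁ ∂_k + r₂ ∂_l` have a common
first integral which agrees with any given function of the other variables modulo `X_i`, `X_j`. -/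
theorem exists_first_integral {i j k l : Fin n} (hij : j ≠ i) (hki : k ≠ i) (hli : l ≠ i)
    (hkj : k ≠ j) (hlj : l ≠ j) (p₁ p₂ r₁ r₂ : MvPowerSeries (Fin n) ℝ)
    (h₁ : transport i k l p₁ p₂ r₁ = transport j k l r₁ r₂ p₁)
    (h₂ : transport i k l p₁ p₂ r₂ = transport j k l r₁ r₂ p₂)
    (s : MvPowerSeries (Fin n) ℝ) :
    ∃ φ, transport i k l p₁ p₂ φ = 0 ∧ transport j k l r₁ r₂ φ = 0 ∧
      ∃ f g, X i ∣ f ∧ X j ∣ g ∧ φ = s + f + g := by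
  have hdvd : ∀ (a : Fin n) (q₁ q₂ : MvPowerSeries (Fin n) ℝ), k ≠ a → l ≠ a → ∀ m r,
      (X a : MvPowerSeries (Fin n) ℝ) ^ m ∣ r →
      X a ^ m ∣ (q₁ • pderiv ℝ k + q₂ • pderiv ℝ l : Derivation ℝ _ _).toLinearMap r :=
    fun a q₁ q₂ hk hl m r hr =>
      dvd_add ((X_pow_dvd_pderiv hk hr).mul_left _) ((X_pow_dvd_pderiv hl hr).mul_left _)
  have htr : ∀ (a : Fin n) (q₁ q₂ r : MvPowerSeries (Fin n) ℝ), pderiv ℝ a r +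
      (q₁ • pderiv ℝ k + q₂ • pderiv ℝ l : Derivation ℝ _ _).toLinearMap r
        = transport a k l q₁ q₂ r :=
    fun a q₁ q₂ r => (add_assoc _ _ _).symm
  -- The commutator has only ∂_k and ∂_l components, and these vanish by `h₁` and `h₂`.
  have hcomm : ∀ r, transport i k l p₁ p₂ (transport j k l r₁ r₂ r)
      = transport j k l r₁ r₂ (transport i k l p₁ p₂ r) := by
    intro r
    have h₁' := h₁
    have h₂' := h₂
    simp only [transport_apply] at h₁' h₂'
    simp only [transport_apply, map_add, Derivation.leibniz, smul_eq_mul]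
    rw [pderiv_comm i j, pderiv_comm i k, pderiv_comm i l, pderiv_comm j k, pderiv_comm j l,
      pderiv_comm k l]
    linear_combination pderiv ℝ k r * h₁' + pderiv ℝ l r * h₂'
  -- The correction g makes s - g an integral of the second derivation B; then f makes s - g - f an
  -- integral of the first one, A.
  obtain ⟨g, hg, hgs⟩ := exists_pderiv_add_eq j _ (hdvd j r₁ r₂ hkj hlj)
    (transport j k l r₁ r₂ s)
  rw [htr] at hgs
  obtain ⟨f, hf, hfs⟩ := exists_pderiv_add_eq i _ (hdvd i p₁ p₂ hki hli)
    (transport i k l p₁ p₂ (s - g))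
  rw [htr] at hfs
  have hB : transport j k l r₁ r₂ (s - g) = 0 := by rw [map_sub, hgs, sub_self]
  have hA : transport i k l p₁ p₂ (s - g - f) = 0 := by rw [map_sub, hfs, sub_self]
  refine ⟨s - g - f, hA, ?_, -f, -g, hf.neg_right, hg.neg_right, by ring⟩
  -- The correction f does not spoil the second equation: B (s - g - f) = -B f is divisible by `X i`
  -- and is killed by A, as A and B commute, so uniqueness makes it zero.
  refine eq_zero_of_pderiv_add i _ (hdvd i p₁ p₂ hki hli) ?_ ?_
  · rw [map_sub, hB, zero_sub, dvd_neg]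
    simpa using X_pow_dvd_transport hij hki hli r₁ r₂ (m := 1) (by simpa using hf)
  · rw [htr, hcomm, hA, map_zero]

/-- Shows that the corrections in `exists_first_integral` do not affect the first derivatives at the
origin in the directions k and l. -/
lemma constantCoeff_pderiv_of_X_dvd {i j : Fin n} (h : j ≠ i) {r : MvPowerSeries (Fin n) ℝ}
    (hr : (X i : MvPowerSeries (Fin n) ℝ) ∣ r) : constantCoeff (pderiv ℝ j r) = 0 := by
  have := X_pow_dvd_pderiv h (k := 1) (by simpa using hr)
  rw [pow_one, X_dvd_iff] at this
  simpa using this 0 rfl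

end Series

/-! ### Differential calculus on the infinite jet space -/

section JetCalculus

variable {n m : ℕ} {f h : Jet n m → ℝ}

lemma hasLineDerivAt_of_finite {S : Finset (JetCoord n m)} {g : (S → ℝ) → ℝ}
    (hg : ContDiff ℝ ∞ g) (hf : ∀ θ, f θ = g (fun c => θ c)) (θ η : Jet n m) :
    HasLineDerivAt ℝ f (fderiv ℝ g (fun c => θ c) (fun c => η c)) θ η := by
  have h1 := ((hg.differentiable (by simp)).differentiableAt
    (x := fun c : S => θ c)).hasFDerivAt.hasLineDerivAt (fun c => η c)
  have h2 : (fun t : ℝ => f (θ + t • η))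
      = fun t : ℝ => g ((fun c : S => θ c) + t • fun c : S => η c) := by
    funext t; rw [hf]; rfl
  rw [HasLineDerivAt, h2]
  exact h1

namespace IsSmoothJetFun

lemma hasLineDerivAt (hf : IsSmoothJetFun f) (θ η : Jet n m) :
    HasLineDerivAt ℝ f (lineDeriv ℝ f θ η) θ η := by
  obtain ⟨S, g, hg, h⟩ := hf
  exact (hasLineDerivAt_of_finite hg h θ η).lineDifferentiableAt.hasLineDerivAt

lemma lineDeriv_add_dir (hf : IsSmoothJetFun f) (θ η ζ : Jet n m) :
    lineDeriv ℝ f θ (η + ζ) = lineDeriv ℝ f θ η + lineDeriv ℝ f θ ζ := by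
  obtain ⟨S, g, hg, h⟩ := hf
  simp only [(hasLineDerivAt_of_finite hg h θ _).lineDeriv, ← map_add]
  rfl

/-- The set S is the same for all jets and directions; this is why the linearization of f has finite
order. -/
lemma exists_lineDeriv_eq_sum (hf : IsSmoothJetFun f) : ∃ S : Finset (JetCoord n m),
    ∀ θ η, lineDeriv ℝ f θ η = ∑ c ∈ S, lineDeriv ℝ f θ (Pi.single c 1) * η c := by
  obtain ⟨S, g, hg, h⟩ := hf
  refine ⟨S, fun θ η => ?_⟩
  simp only [(hasLineDerivAt_of_finite hg h θ _).lineDeriv]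
  rw [← Finset.sum_coe_sort S]
  have : (fun c : S => η c)
      = ∑ c : S, η c • (fun c' : S => (Pi.single (c : JetCoord n m) (1 : ℝ) : Jet n m) c') := by
    funext c'
    rw [Finset.sum_apply, Finset.sum_eq_single c']
    · rw [Pi.smul_apply, Pi.single_eq_same, smul_eq_mul, mul_one]
    · intro c _ hc
      rw [Pi.smul_apply, Pi.single_eq_of_ne (fun h => hc (Subtype.ext h.symm)), smul_zero]
    · exact fun h => absurd (Finset.mem_univ _) h
  conv_lhs => rw [this, map_sum]
  simp [mul_comm]

lemma lineDeriv_dir (hf : IsSmoothJetFun f) (η : Jet n m) :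
    IsSmoothJetFun fun θ => lineDeriv ℝ f θ η := by
  obtain ⟨S, g, hg, h⟩ := hf
  refine ⟨S, fun p => fderiv ℝ g p (fun c => η c), ?_, fun θ =>
    (hasLineDerivAt_of_finite hg h θ _).lineDeriv⟩
  exact (hg.fderiv_right (m := ∞) (by simp)).clm_apply contDiff_const

lemma lineDeriv_comm (hf : IsSmoothJetFun f) (θ η ζ : Jet n m) :
    lineDeriv ℝ (fun θ' => lineDeriv ℝ f θ' η) θ ζ
      = lineDeriv ℝ (fun θ' => lineDeriv ℝ f θ' ζ) θ η := by
  obtain ⟨S, g, hg, h⟩ := hf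
  have key : ∀ η ζ : Jet n m, lineDeriv ℝ (fun θ' => lineDeriv ℝ f θ' η) θ ζ
      = fderiv ℝ (fderiv ℝ g) (fun c => θ c) (fun c => ζ c) (fun c => η c) := by
    intro η ζ
    have hg' : ContDiff ℝ ∞ (fderiv ℝ g) := hg.fderiv_right (m := ∞) (by simp)
    have h1 := hasLineDerivAt_of_finite (f := fun θ' => lineDeriv ℝ f θ' η)
      (g := fun p => fderiv ℝ g p (fun c : S => η c)) (hg'.clm_apply contDiff_const)
      (fun θ => (hasLineDerivAt_of_finite hg h θ _).lineDeriv) θ ζ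
    rw [h1.lineDeriv, fderiv_clm_apply (hg'.differentiable (by simp)).differentiableAt
      (differentiableAt_const _)]
    simp
  rw [key, key]
  exact (hg.contDiffAt.isSymmSndFDerivAt
    (by simpa using WithTop.coe_le_coe.2 (le_top (a := (2 : ℕ∞))))).eq _ _

lemma const (a : ℝ) : IsSmoothJetFun fun _ : Jet n m => a :=
  ⟨∅, fun _ => a, contDiff_const, fun _ => rfl⟩

lemma coord (c : JetCoord n m) : IsSmoothJetFun fun θ : Jet n m => θ c :=
  ⟨{c}, fun p => p ⟨c, Finset.mem_singleton_self c⟩, contDiff_apply _ _ _, fun _ => rfl⟩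

lemma comp₂ {F : ℝ × ℝ → ℝ} (hF : ContDiff ℝ ∞ F) (hf : IsSmoothJetFun f)
    (hh : IsSmoothJetFun h) : IsSmoothJetFun fun θ => F (f θ, h θ) := by
  classical
  obtain ⟨S, g, hg, h1⟩ := hf
  obtain ⟨S', g', hg', h2⟩ := hh
  refine ⟨S ∪ S', fun p => F (g fun c => p ⟨c, Finset.mem_union_left _ c.2⟩,
    g' fun c => p ⟨c, Finset.mem_union_right _ c.2⟩), ?_, fun θ => by simp only [h1, h2]⟩
  exact hF.comp ((hg.comp (contDiff_pi.2 fun c => contDiff_apply _ _ _)).prodMk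
    (hg'.comp (contDiff_pi.2 fun c => contDiff_apply _ _ _)))

lemma add (hf : IsSmoothJetFun f) (hh : IsSmoothJetFun h) :
    IsSmoothJetFun fun θ => f θ + h θ :=
  comp₂ (F := fun p => p.1 + p.2) (by fun_prop) hf hh

lemma mul (hf : IsSmoothJetFun f) (hh : IsSmoothJetFun h) :
    IsSmoothJetFun fun θ => f θ * h θ :=
  comp₂ (F := fun p => p.1 * p.2) (by fun_prop) hf hh

lemma sub (hf : IsSmoothJetFun f) (hh : IsSmoothJetFun h) :
    IsSmoothJetFun fun θ => f θ - h θ :=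
  comp₂ (F := fun p => p.1 - p.2) (by fun_prop) hf hh

lemma neg (hf : IsSmoothJetFun f) : IsSmoothJetFun fun θ => -f θ :=
  comp₂ (F := fun p => -p.1) (by fun_prop) hf hf

lemma sum {ι : Type*} {S : Finset ι} {F : ι → Jet n m → ℝ} (hF : ∀ c, IsSmoothJetFun (F c)) :
    IsSmoothJetFun fun θ => ∑ c ∈ S, F c θ := by
  classical
  induction S using Finset.induction_on with
  | empty => simpa using const 0
  | insert c S hc ih => simpa [Finset.sum_insert hc] using (hF c).add ih

lemma cartanVec (i : Fin n) (c : JetCoord n m) : IsSmoothJetFun fun θ => cartanVec i θ c :=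
  match c with
  | Sum.inl _ => const _
  | Sum.inr _ => coord _

lemma totalD (hf : IsSmoothJetFun f) (i : Fin n) : IsSmoothJetFun (totalD i f) := by
  obtain ⟨S, hS⟩ := hf.exists_lineDeriv_eq_sum
  have : _root_.totalD i f
      = fun θ => ∑ c ∈ S, lineDeriv ℝ f θ (Pi.single c 1) * _root_.cartanVec i θ c :=
    funext fun θ => hS θ _
  rw [this]
  exact sum fun c => (hf.lineDeriv_dir _).mul (cartanVec i c)

lemma totalDs (hf : IsSmoothJetFun f) (l : List (Fin n)) : IsSmoothJetFun (totalDs l f) := by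
  induction l with
  | nil => exact hf
  | cons i l ih => exact ih.totalD i

end IsSmoothJetFun

/-- The linear part of the vector field `D_i`. -/
def shift (i : Fin n) (η : Jet n m) : Jet n m
  | Sum.inl _ => 0
  | Sum.inr (a, σ) => η (Sum.inr (a, σ + Pi.single i 1))

lemma cartanVec_add_smul (i : Fin n) (θ η : Jet n m) (t : ℝ) :
    cartanVec i (θ + t • η) = cartanVec i θ + t • shift i η := by
  funext c
  rcases c with j | ⟨a, σ⟩ <;> simp [cartanVec, shift]

lemma shift_cartanVec_comm (i j : Fin n) (θ : Jet n m) :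
    shift i (cartanVec j θ) = shift j (cartanVec i θ) := by
  funext c
  rcases c with k | ⟨a, σ⟩ <;> simp [cartanVec, shift, add_right_comm]

/-- The derivative of a total derivative. -/
lemma IsSmoothJetFun.lineDeriv_totalD (hf : IsSmoothJetFun f) (i : Fin n) (θ η : Jet n m) :
    lineDeriv ℝ (_root_.totalD i f) θ η
      = lineDeriv ℝ (fun θ' => lineDeriv ℝ f θ' η) θ (_root_.cartanVec i θ)
        + lineDeriv ℝ f θ (shift i η) := by
  rw [← hf.lineDeriv_comm]
  refine HasLineDerivAt.lineDeriv ?_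
  -- The field D_i is affine in the jet with linear part `shift i`, so moving along η changes both
  -- the base point and, linearly in t, the direction.
  have h1 : (fun t : ℝ => _root_.totalD i f (θ + t • η))
      = fun t : ℝ => lineDeriv ℝ f (θ + t • η) (_root_.cartanVec i θ)
        + t * lineDeriv ℝ f (θ + t • η) (shift i η) := by
    funext t
    rw [_root_.totalD, cartanVec_add_smul, hf.lineDeriv_add_dir, lineDeriv_smul, smul_eq_mul]
  rw [HasLineDerivAt, h1]
  have h2 := (hf.lineDeriv_dir (_root_.cartanVec i θ)).hasLineDerivAt θ η
  have h3 := (hf.lineDeriv_dir (shift i η)).hasLineDerivAt θ η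
  rw [HasLineDerivAt] at h2 h3
  have h4 := h2.add ((hasDerivAt_id (0 : ℝ)).mul h3)
  refine (h4.congr_deriv ?_)
  simp

/-- Both sides are a second derivative of f plus a first derivative; the former is symmetric, and
the latter agree because D_i and D_j commute as vector fields. -/
lemma IsSmoothJetFun.totalD_comm (hf : IsSmoothJetFun f) (i j : Fin n) :
    _root_.totalD i (_root_.totalD j f) = _root_.totalD j (_root_.totalD i f) := by
  funext θ
  change lineDeriv ℝ (_root_.totalD j f) θ _ = lineDeriv ℝ (_root_.totalD i f) θ _
  rw [hf.lineDeriv_totalD, hf.lineDeriv_totalD, hf.lineDeriv_comm, shift_cartanVec_comm]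

lemma IsSmoothJetFun.totalDs_totalD (hf : IsSmoothJetFun f) (i : Fin n) (l : List (Fin n)) :
    _root_.totalDs l (_root_.totalD i f) = _root_.totalD i (_root_.totalDs l f) := by
  induction l with
  | nil => rfl
  | cons j l ih =>
    change _root_.totalD j (_root_.totalDs l _) = _
    rw [ih, (hf.totalDs l).totalD_comm]
    rfl

lemma IsSmoothJetFun.totalDs_perm (hf : IsSmoothJetFun f) {l l' : List (Fin n)}
    (hl : l.Perm l') : _root_.totalDs l f = _root_.totalDs l' f := by
  induction hl with
  | nil => rfl
  | cons i _ ih => exact congrArg (_root_.totalD i) ih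
  | swap i j l => exact (hf.totalDs l).totalD_comm j i
  | trans _ _ ih₁ ih₂ => exact ih₁.trans ih₂

lemma IsSmoothJetFun.totalDs_multiList (hf : IsSmoothJetFun f) (l : List (Fin n)) :
    _root_.totalDs (multiList fun i => l.count i) f = _root_.totalDs l f :=
  hf.totalDs_perm (List.perm_iff_count.2 fun i => congrFun (count_multiList _) i)

lemma totalD_add (hf : IsSmoothJetFun f) (hh : IsSmoothJetFun h) (i : Fin n) :
    totalD i (fun θ => f θ + h θ) = fun θ => totalD i f θ + totalD i h θ := by
  funext θ
  have h1 := hf.hasLineDerivAt θ (cartanVec i θ)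
  have h2 := hh.hasLineDerivAt θ (cartanVec i θ)
  exact HasLineDerivAt.lineDeriv (HasDerivAt.add h1 h2)

lemma totalD_mul (hf : IsSmoothJetFun f) (hh : IsSmoothJetFun h) (i : Fin n) :
    totalD i (fun θ => f θ * h θ) = fun θ => totalD i f θ * h θ + f θ * totalD i h θ := by
  funext θ
  have h1 := hf.hasLineDerivAt θ (cartanVec i θ)
  have h2 := hh.hasLineDerivAt θ (cartanVec i θ)
  have h3 : HasLineDerivAt ℝ (fun θ => f θ * h θ) _ θ (cartanVec i θ) := HasDerivAt.mul h1 h2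
  simp only [zero_smul, add_zero] at h3
  exact h3.lineDeriv

lemma totalD_const (a : ℝ) (i : Fin n) :
    totalD i (fun _ : Jet n m => a) = fun _ => 0 := by
  funext θ
  exact HasLineDerivAt.lineDeriv (hasDerivAt_const _ _)

lemma totalD_coord (a : Fin m) (σ : Fin n → ℕ) (i : Fin n) :
    totalD i (fun θ : Jet n m => θ (Sum.inr (a, σ)))
      = fun θ => θ (Sum.inr (a, σ + Pi.single i 1)) := by
  funext θ
  have : HasLineDerivAt ℝ (fun θ : Jet n m => θ (Sum.inr (a, σ)))
      (cartanVec i θ (Sum.inr (a, σ))) θ (cartanVec i θ) := by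
    rw [HasLineDerivAt]
    simpa using ((hasDerivAt_id (0 : ℝ)).mul_const
      (cartanVec i θ (Sum.inr (a, σ)))).const_add (θ (Sum.inr (a, σ)))
  exact this.lineDeriv

end JetCalculus

/-! ### Taylor series of jet functions along a formal solution -/

section JetSeries

open MvPowerSeries

variable {n m : ℕ} {f h : Jet n m → ℝ}

/-- The Taylor series of a jet function along the formal solution `θ`. -/
noncomputable def jetSeries (f : Jet n m → ℝ) (θ : Jet n m) : MvPowerSeries (Fin n) ℝ :=
  taylor fun σ => totalDs (multiList σ) f θ

/-- The `a`-th component of a jet as a formal power series. -/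
noncomputable def component (a : Fin m) (θ : Jet n m) : MvPowerSeries (Fin n) ℝ :=
  taylor fun σ => θ (Sum.inr (a, σ))

lemma derivCoeff_component (a : Fin m) (θ : Jet n m) (σ : Fin n → ℕ) :
    derivCoeff σ (component a θ) = θ (Sum.inr (a, σ)) := derivCoeff_taylor _ _

lemma constantCoeff_pderivs_jetSeries (hf : IsSmoothJetFun f) (l : List (Fin n)) (θ : Jet n m) :
    constantCoeff (pderivs l (jetSeries f θ)) = totalDs l f θ := by
  rw [constantCoeff_pderivs, jetSeries, derivCoeff_taylor, hf.totalDs_multiList]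

lemma constantCoeff_jetSeries (hf : IsSmoothJetFun f) (θ : Jet n m) :
    constantCoeff (jetSeries f θ) = f θ :=
  constantCoeff_pderivs_jetSeries hf [] θ

/-- Along a jet, total derivatives become formal partial derivatives. With multiplicativity below,
this turns differential equations on jets into equations between power series. -/
lemma pderiv_jetSeries (hf : IsSmoothJetFun f) (i : Fin n) (θ : Jet n m) :
    pderiv ℝ i (jetSeries f θ) = jetSeries (totalD i f) θ :=
  ext_pderivs fun l => by
    rw [constantCoeff_pderivs_jetSeries (hf.totalD i), hf.totalDs_totalD, pderivs_pderiv,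
      ← pderivs_cons, constantCoeff_pderivs_jetSeries hf]
    rfl

lemma totalDs_add (hf : IsSmoothJetFun f) (hh : IsSmoothJetFun h) (l : List (Fin n)) :
    totalDs l (fun θ => f θ + h θ) = fun θ => totalDs l f θ + totalDs l h θ := by
  induction l with
  | nil => rfl
  | cons i l ih =>
    change totalD i (totalDs l _) = _
    rw [ih, totalD_add (hf.totalDs l) (hh.totalDs l)]
    rfl

lemma jetSeries_add (hf : IsSmoothJetFun f) (hh : IsSmoothJetFun h) (θ : Jet n m) :
    jetSeries (fun θ => f θ + h θ) θ = jetSeries f θ + jetSeries h θ :=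
  ext_derivCoeff fun σ => by
    simp only [jetSeries, derivCoeff_add, derivCoeff_taylor, totalDs_add hf hh]

lemma jetSeries_mul (hf : IsSmoothJetFun f) (hh : IsSmoothJetFun h) (θ : Jet n m) :
    jetSeries (fun θ => f θ * h θ) θ = jetSeries f θ * jetSeries h θ := by
  refine ext_pderivs fun l => ?_
  induction l generalizing f h with
  | nil =>
    simp [constantCoeff_jetSeries hf, constantCoeff_jetSeries hh,
      constantCoeff_jetSeries (hf.mul hh)]
  | cons i l ih =>
    rw [pderivs_cons, pderivs_cons, ← pderivs_pderiv, ← pderivs_pderiv,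
      pderiv_jetSeries (hf.mul hh), totalD_mul hf hh,
      jetSeries_add ((hf.totalD i).mul hh) (hf.mul (hh.totalD i)), map_add, map_add,
      ih (hf.totalD i) hh, ih hf (hh.totalD i), Derivation.leibniz, pderiv_jetSeries hf,
      pderiv_jetSeries hh, ← map_add, ← map_add]
    congr 2
    simp only [smul_eq_mul]
    ring

lemma jetSeries_const (a : ℝ) (θ : Jet n m) : jetSeries (fun _ => a) θ = C a := by
  have h0 : ∀ l : List (Fin n), totalDs l (fun _ : Jet n m => (0 : ℝ)) = fun _ => 0 := by
    intro l
    induction l with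
    | nil => rfl
    | cons i l ih => change totalD i (totalDs l _) = _; rw [ih, totalD_const]
  have h1 : jetSeries (fun _ : Jet n m => (0 : ℝ)) θ = 0 :=
    ext_derivCoeff fun σ => by
      rw [jetSeries, derivCoeff_taylor, h0, derivCoeff_zero_right]
  refine pderiv.ext (fun i => ?_) ?_
  · rw [pderiv_jetSeries (.const a), totalD_const, h1, pderiv_C]
  · rw [constantCoeff_jetSeries (.const a), constantCoeff_C]

lemma jetSeries_neg (hf : IsSmoothJetFun f) (θ : Jet n m) :
    jetSeries (fun θ => -f θ) θ = -jetSeries f θ := by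
  have := jetSeries_mul (.const (-1)) hf θ
  rw [jetSeries_const] at this
  simpa using this

lemma jetSeries_sub (hf : IsSmoothJetFun f) (hh : IsSmoothJetFun h) (θ : Jet n m) :
    jetSeries (fun θ => f θ - h θ) θ = jetSeries f θ - jetSeries h θ := by
  have := jetSeries_add hf hh.neg θ
  rw [jetSeries_neg hh] at this
  simpa only [sub_eq_add_neg] using this

lemma isSmoothJetFun_jetD (a : Fin m) (l : List (Fin n)) :
    IsSmoothJetFun fun θ : Jet n m => jetD a l θ := .coord _

lemma jetSeries_jetD (a : Fin m) (l : List (Fin n)) (θ : Jet n m) :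
    jetSeries (fun θ => jetD a l θ) θ = pderivs l (component a θ) := by
  have h1 : ∀ (l' : List (Fin n)) (σ : Fin n → ℕ),
      totalDs l' (fun θ : Jet n m => θ (Sum.inr (a, σ)))
        = fun θ => θ (Sum.inr (a, σ + fun i => l'.count i)) := by
    intro l' σ
    induction l' with
    | nil => simp only [List.count_nil]; rfl
    | cons i l' ih =>
      change totalD i (totalDs l' _) = _
      rw [ih, totalD_coord, count_cons_eq, add_assoc]
  refine ext_derivCoeff fun σ => ?_
  rw [derivCoeff_pderivs, jetSeries, derivCoeff_taylor, derivCoeff_component]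
  change totalDs _ (fun θ : Jet n m => θ (Sum.inr (a, fun i => l.count i))) θ = _
  rw [h1, count_multiList, add_comm]

/-- The total derivatives of F k at θ are exactly the Taylor coefficients of its series, so a jet in
the prolongation is a formal solution. -/
lemma mem_prolongation_iff {ι : Type} {F : ι → Jet n m → ℝ} (hF : ∀ k, IsSmoothJetFun (F k))
    (θ : Jet n m) : θ ∈ prolongation F ↔ ∀ k, jetSeries (F k) θ = 0 := by
  refine forall_congr' fun k => ⟨fun h => ext_pderivs fun l => ?_, fun h l => ?_⟩
  · rw [constantCoeff_pderivs_jetSeries (hF k), h l, map_zero, map_zero]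
  · rw [← constantCoeff_pderivs_jetSeries (hF k), h, map_zero, map_zero]

/-! ### Linearization of a jet function -/

lemma isSmoothJetFun_constantCoeff_pderivs_mul (hf : IsSmoothJetFun f) (l : List (Fin n))
    (r : MvPowerSeries (Fin n) ℝ) :
    IsSmoothJetFun fun θ => constantCoeff (pderivs l (jetSeries f θ * r)) := by
  induction l generalizing f r with
  | nil => simpa [constantCoeff_jetSeries hf] using hf.mul (.const (constantCoeff r))
  | cons i l ih =>
    have h1 := (ih hf (pderiv ℝ i r)).add (ih (hf.totalD i) r)
    simpa [← pderivs_pderiv, pderiv_jetSeries hf, mul_comm, add_comm] using h1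

lemma totalD_constantCoeff_pderivs_mul (hf : IsSmoothJetFun f) (i : Fin n) (l : List (Fin n))
    (r : MvPowerSeries (Fin n) ℝ) :
    totalD i (fun θ => constantCoeff (pderivs l (jetSeries f θ * r)))
      = fun θ => constantCoeff (pderivs l (jetSeries (totalD i f) θ * r)) := by
  induction l generalizing f r with
  | nil =>
    simp only [pderivs_nil, map_mul, constantCoeff_jetSeries hf,
      constantCoeff_jetSeries (hf.totalD i)]
    rw [totalD_mul hf (.const _), totalD_const]
    simp
  | cons j l ih =>
    have h1 : ∀ {g : Jet n m → ℝ}, IsSmoothJetFun g →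
        (fun θ => constantCoeff (pderivs (j :: l) (jetSeries g θ * r)))
        = fun θ => constantCoeff (pderivs l (jetSeries g θ * pderiv ℝ j r))
          + constantCoeff (pderivs l (jetSeries (totalD j g) θ * r)) := by
      intro g hg
      funext θ
      simp [← pderivs_pderiv, pderiv_jetSeries hg, mul_comm, add_comm]
    rw [h1 hf, h1 (hf.totalD i), totalD_add (isSmoothJetFun_constantCoeff_pderivs_mul hf _ _)
      (isSmoothJetFun_constantCoeff_pderivs_mul (hf.totalD j) _ _), ih hf, ih (hf.totalD j),
      hf.totalD_comm]

lemma totalD_sum {ι : Type*} (S : Finset ι) {F : ι → Jet n m → ℝ}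
    (hF : ∀ c, IsSmoothJetFun (F c)) (i : Fin n) :
    totalD i (fun θ => ∑ c ∈ S, F c θ) = fun θ => ∑ c ∈ S, totalD i (F c) θ := by
  classical
  induction S using Finset.induction_on with
  | empty => simpa using totalD_const 0 i
  | insert c S hc ih =>
    simp only [Finset.sum_insert hc]
    rw [totalD_add (hF c) (IsSmoothJetFun.sum hF), ih]

/-- The vertical direction in the jet space given by the variation `δ` of the `a`-th dependent
variable. -/
noncomputable def variation (a : Fin m) (δ : MvPowerSeries (Fin n) ℝ) : Jet n m
  | Sum.inl _ => 0
  | Sum.inr (b, σ) => if b = a then derivCoeff σ δ else 0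

lemma shift_variation (i : Fin n) (a : Fin m) (δ : MvPowerSeries (Fin n) ℝ) :
    shift i (variation a δ) = variation a (pderiv ℝ i δ) := by
  funext c
  rcases c with j | ⟨b, σ⟩ <;> simp [shift, variation, derivCoeff_pderiv]

lemma component_add_smul_variation (a b : Fin m) (θ : Jet n m) (t : ℝ)
    (δ : MvPowerSeries (Fin n) ℝ) :
    component b (θ + t • variation a δ) = component b θ + if b = a then t • δ else 0 := by
  refine ext_derivCoeff fun σ => ?_
  rw [derivCoeff_component, derivCoeff_add, derivCoeff_component]
  by_cases h : b = a <;> simp [variation, h, derivCoeff_smul, derivCoeff_zero_right]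

/-- Linearization commutes with total derivatives. By `lineDeriv_totalD` a further D_i hits either
the coefficient or the variation, and the two terms form the Leibniz rule for the product of power
series. -/
lemma lineDeriv_totalDs_variation {ι : Type*} (S : Finset ι) {F : ι → Jet n m → ℝ}
    (hF : ∀ c, IsSmoothJetFun (F c)) (L : ι → List (Fin n)) (hf : IsSmoothJetFun f) (a : Fin m)
    (h : ∀ θ δ, lineDeriv ℝ f θ (variation a δ)
      = ∑ c ∈ S, F c θ * constantCoeff (pderivs (L c) δ))
    (l : List (Fin n)) (θ : Jet n m) (δ : MvPowerSeries (Fin n) ℝ) :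
    lineDeriv ℝ (totalDs l f) θ (variation a δ)
      = ∑ c ∈ S, constantCoeff (pderivs l (jetSeries (F c) θ * pderivs (L c) δ)) := by
  induction l generalizing θ δ with
  | nil =>
    change lineDeriv ℝ f θ (variation a δ) = _
    simp [h, constantCoeff_jetSeries (hF _)]
  | cons i l ih =>
    change lineDeriv ℝ (totalD i (totalDs l f)) θ _ = _
    rw [(hf.totalDs l).lineDeriv_totalD, shift_variation, ih,
      show (fun θ' => lineDeriv ℝ (totalDs l f) θ' (variation a δ)) = _ from
        funext fun θ' => ih θ' δ]
    change totalD i _ θ + _ = _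
    rw [totalD_sum S fun c => isSmoothJetFun_constantCoeff_pderivs_mul (hF c) _ _,
      ← Finset.sum_add_distrib]
    refine Finset.sum_congr rfl fun c _ => ?_
    rw [totalD_constantCoeff_pderivs_mul (hF c), pderivs_cons, ← pderivs_pderiv,
      Derivation.leibniz, pderiv_jetSeries (hF c), ← map_add, ← map_add, pderivs_pderiv]
    congr 2
    simp only [smul_eq_mul]
    ring

/-- The linearization of a smooth jet function is a formal differential operator. -/
theorem exists_linearization (hf : IsSmoothJetFun f) (a : Fin m) (θ : Jet n m) :
    ∃ T : Module.End ℝ (MvPowerSeries (Fin n) ℝ),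
      (∀ φ, ∃ k, (adMul φ ^ k) T = 0) ∧
      ∀ δ l, lineDeriv ℝ (totalDs l f) θ (variation a δ) = constantCoeff (pderivs l (T δ)) := by
  obtain ⟨S, hS⟩ := hf.exists_lineDeriv_eq_sum
  let L : JetCoord n m → List (Fin n) := Sum.elim (fun _ => []) fun p => multiList p.2
  let F : JetCoord n m → Jet n m → ℝ := Sum.elim (fun _ _ => 0) fun p θ =>
    -- These are the coefficients ∂f/∂u^a_σ of the linearization; base coordinates and other
    -- dependent variables do not contribute.
    (if p.1 = a then 1 else 0) * lineDeriv ℝ f θ (Pi.single (Sum.inr p) 1)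
  have hF : ∀ c, IsSmoothJetFun (F c) := by
    rintro (_ | p)
    · exact .const 0
    · exact (IsSmoothJetFun.const _).mul (hf.lineDeriv_dir _)
  refine ⟨∑ c ∈ S, LinearMap.mulLeft ℝ (jetSeries (F c) θ) * pderivs (L c),
    fun φ => exists_adMul_pow_sum S _ L φ, fun δ l => ?_⟩
  rw [lineDeriv_totalDs_variation S hF L hf a]
  · simp only [LinearMap.sum_apply, map_sum]
    rfl
  · intro θ δ
    rw [hS]
    refine Finset.sum_congr rfl fun c _ => ?_
    rcases c with j | ⟨b, σ⟩
    · simp [F, variation]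
    · by_cases hb : b = a <;>
        simp [F, L, variation, hb, constantCoeff_pderivs, count_multiList]

end JetSeries

/-! ### The obstruction to lifting -/

section Lifts

open MvPowerSeries

variable {n m : ℕ}

lemma hasDerivAt_derivCoeff_pderiv {G : ℝ → MvPowerSeries (Fin n) ℝ} {G' : MvPowerSeries (Fin n) ℝ}
    {x : ℝ} (h : ∀ σ, HasDerivAt (fun t => derivCoeff σ (G t)) (derivCoeff σ G') x)
    (i : Fin n) (σ : Fin n → ℕ) :
    HasDerivAt (fun t => derivCoeff σ (pderiv ℝ i (G t))) (derivCoeff σ (pderiv ℝ i G')) x := by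
  simp only [derivCoeff_pderiv]
  exact h _

/-- Each coefficient of a product is a finite sum, so differentiation in a parameter can be done
coefficientwise, without any convergence. -/
lemma hasDerivAt_derivCoeff_mul {G : ℝ → MvPowerSeries (Fin n) ℝ} {G' : MvPowerSeries (Fin n) ℝ}
    {x : ℝ} (h : ∀ σ, HasDerivAt (fun t => derivCoeff σ (G t)) (derivCoeff σ G') x)
    (p : MvPowerSeries (Fin n) ℝ) (σ : Fin n → ℕ) :
    HasDerivAt (fun t => derivCoeff σ (p * G t)) (derivCoeff σ (p * G')) x := by
  have hc : ∀ (τ : Fin n →₀ ℕ) (r : MvPowerSeries (Fin n) ℝ),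
      coeff τ r = (∏ i, ((τ i).factorial : ℝ))⁻¹ * derivCoeff (⇑τ) r := by
    intro τ r
    have := prod_factorial_ne_zero (⇑τ)
    simp only [derivCoeff, Finsupp.equivFunOnFinite_symm_coe]
    field_simp
  simp only [derivCoeff, coeff_mul]
  refine HasDerivAt.const_mul _ (HasDerivAt.fun_sum fun ab _ => HasDerivAt.const_mul _ ?_)
  simp only [hc]
  exact (h _).const_mul _

lemma hasDerivAt_derivCoeff_transport {G : ℝ → MvPowerSeries (Fin n) ℝ}
    {G' : MvPowerSeries (Fin n) ℝ} {x : ℝ}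
    (h : ∀ σ, HasDerivAt (fun t => derivCoeff σ (G t)) (derivCoeff σ G') x)
    (i k l : Fin n) (p₁ p₂ : MvPowerSeries (Fin n) ℝ) (σ : Fin n → ℕ) :
    HasDerivAt (fun t => derivCoeff σ (transport i k l p₁ p₂ (G t)))
      (derivCoeff σ (transport i k l p₁ p₂ G')) x := by
  simp only [transport_apply, derivCoeff_add]
  exact ((hasDerivAt_derivCoeff_pderiv h i σ).add
    (hasDerivAt_derivCoeff_mul (hasDerivAt_derivCoeff_pderiv h k) p₁ σ)).add
    (hasDerivAt_derivCoeff_mul (hasDerivAt_derivCoeff_pderiv h l) p₂ σ)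

/-- If `f` solves a transport equation along a line of jets, so does its linearization. -/
lemma transport_linearization_eq_zero {f : Jet n m → ℝ} (hf : IsSmoothJetFun f) {a : Fin m}
    {θ : Jet n m} {T : Module.End ℝ (MvPowerSeries (Fin n) ℝ)}
    (hT : ∀ δ l, lineDeriv ℝ (totalDs l f) θ (variation a δ) = constantCoeff (pderivs l (T δ)))
    {i k l : Fin n} {p₁ p₂ δ : MvPowerSeries (Fin n) ℝ}
    (h : ∀ᶠ t in 𝓝 (0 : ℝ), transport i k l p₁ p₂ (jetSeries f (θ + t • variation a δ)) = 0) :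
    transport i k l p₁ p₂ (T δ) = 0 := by
  have h1 : ∀ σ, HasDerivAt (fun t : ℝ => derivCoeff σ (jetSeries f (θ + t • variation a δ)))
      (derivCoeff σ (T δ)) 0 := by
    intro σ
    have h2 := (hf.totalDs (multiList σ)).hasLineDerivAt θ (variation a δ)
    rw [hT, constantCoeff_pderivs, count_multiList] at h2
    rw [HasLineDerivAt] at h2
    simpa only [jetSeries, derivCoeff_taylor] using h2
  refine ext_derivCoeff fun σ => ?_
  refine (hasDerivAt_derivCoeff_transport h1 i k l p₁ p₂ σ).unique ?_
  rw [derivCoeff_zero_right]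
  refine (hasDerivAt_const (0 : ℝ) (0 : ℝ)).congr_of_eventuallyEq ?_
  filter_upwards [h] with t ht
  rw [ht, derivCoeff_zero_right]

lemma prod_map_eq_prod_pow_count (s : Fin n → ℝ) (l : List (Fin n)) :
    (l.map s).prod = ∏ i, s i ^ l.count i := by
  rw [Finset.prod_list_map_count]
  exact Finset.prod_subset (Finset.subset_univ _) fun i _ hi => by
    rw [List.count_eq_zero_of_not_mem (by simpa using hi), pow_zero]

lemma continuous_add_smul (θ η : Jet n m) : Continuous fun t : ℝ => θ + t • η := by
  fun_prop

/-- A lift of a scaling to a system consisting of equations for `(v, w)` and two transport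
equations for `q` which changes the coefficients of the transport equations does not exist if
there is a formal solution of the original transport equations
which does not solve the changed ones. -/
theorem not_liftsLocally_scaling {i j k l : Fin 4}
    {B : MvPowerSeries (Fin 4) ℝ → MvPowerSeries (Fin 4) ℝ → Prop}
    {p₁ p₂ r₁ r₂ p₁' p₂' r₁' r₂' :
      MvPowerSeries (Fin 4) ℝ → MvPowerSeries (Fin 4) ℝ → MvPowerSeries (Fin 4) ℝ}
    {E E' : Set (Jet 4 3)} {s : Fin 4 → ℝ} {c : Fin 2 → ℝ} (hs : ∀ i, s i ≠ 0) (hc : ∀ a, c a ≠ 0)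
    (hE : ∀ θ, θ ∈ E ↔ B (component 0 θ) (component 1 θ) ∧
      transport i k l (p₁ (component 0 θ) (component 1 θ)) (p₂ (component 0 θ) (component 1 θ))
        (component 2 θ) = 0 ∧
      transport j k l (r₁ (component 0 θ) (component 1 θ)) (r₂ (component 0 θ) (component 1 θ))
        (component 2 θ) = 0)
    (hE' : ∀ θ ∈ E', ∀ θ', θ' = scaling s⁻¹ ![(c 0)⁻¹, (c 1)⁻¹, 1] θ →
      transport i k l (p₁' (component 0 θ') (component 1 θ'))
        (p₂' (component 0 θ') (component 1 θ')) (component 2 θ') = 0 ∧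
      transport j k l (r₁' (component 0 θ') (component 1 θ'))
        (r₂' (component 0 θ') (component 1 θ')) (component 2 θ') = 0)
    (hreg : ∀ θ ∈ E, ∀ U, IsOpen U → θ ∈ U → ∃ θ' ∈ E ∩ U, ∃ V W, V = component 0 θ' ∧
      W = component 1 θ' ∧ ∃ φ,
      transport i k l (p₁ V W) (p₂ V W) φ = 0 ∧ transport j k l (r₁ V W) (r₂ V W) φ = 0 ∧
      (transport i k l (p₁' V W) (p₂' V W) φ ≠ 0 ∨ transport j k l (r₁' V W) (r₂' V W) φ ≠ 0)) :
    ¬ LiftsLocally s (scaling s c) E E' := by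
  rintro ⟨U, U', Ψ, Φ, hU, -, ⟨θ₀, hθ₀⟩, hΨ, -, hinv, -, hcart, -, hcov⟩
  obtain ⟨θ, hθ, V, W, hV, hW, φ, hφ₁, hφ₂, hφ⟩ := hreg θ₀ hθ₀.1 U hU hθ₀.2
  obtain ⟨f, hf, hev⟩ := hcart θ hθ
  have hf := hf 2
  rw [eventually_nhdsWithin_iff, eventually_nhds_iff] at hev
  obtain ⟨N', hN', hN'o, hθN'⟩ := hev
  set N := N' ∩ U with hN
  have hNo : IsOpen N := hN'o.inter hU
  have hprod : ∀ σ : Fin 4 → ℕ, (∏ i, s i ^ σ i) ≠ 0 := fun σ =>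
    Finset.prod_ne_zero_iff.2 fun i _ => pow_ne_zero _ (hs i)
  -- Undoing the scaling on Ψ θ' restores the (v, w)-part of θ', while the q-part becomes the Taylor
  -- series of `f 2`, which therefore solves the changed equations.
  have hsol : ∀ θ' ∈ E ∩ N,
      transport i k l (p₁' (component 0 θ') (component 1 θ'))
        (p₂' (component 0 θ') (component 1 θ')) (jetSeries (f 2) θ') = 0 ∧
      transport j k l (r₁' (component 0 θ') (component 1 θ'))
        (r₂' (component 0 θ') (component 1 θ')) (jetSeries (f 2) θ') = 0 := by
    rintro θ' ⟨hθ'E, hθ'N', hθ'U⟩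
    have h1 := hE' _ (hΨ ⟨hθ'E, hθ'U⟩).1 _ rfl
    have h2 := hcov θ' ⟨hθ'E, hθ'U⟩
    have hbase : ∀ a : Fin 2, ∀ σ,
        Ψ θ' (Sum.inr (a.castSucc, σ)) = c a / (∏ i, s i ^ σ i) * θ' (Sum.inr (a.castSucc, σ)) :=
      fun a σ => congrFun h2 (Sum.inr (a, σ))
    have e0 : component 0 (scaling s⁻¹ ![(c 0)⁻¹, (c 1)⁻¹, 1] (Ψ θ')) = component 0 θ' :=
      ext_derivCoeff fun σ => by
        have := hbase 0 σ
        have h3 := hprod σ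
        have h4 := hc 0
        simp only [Fin.castSucc_zero] at this
        simp [derivCoeff_component, scaling, this]
        field_simp
    have e1 : component 1 (scaling s⁻¹ ![(c 0)⁻¹, (c 1)⁻¹, 1] (Ψ θ')) = component 1 θ' :=
      ext_derivCoeff fun σ => by
        have := hbase 1 σ
        have h3 := hprod σ
        have h4 := hc 1
        simp only [Fin.castSucc_one] at this
        simp [derivCoeff_component, scaling, this]
        field_simp
    have e2 : component 2 (scaling s⁻¹ ![(c 0)⁻¹, (c 1)⁻¹, 1] (Ψ θ')) = jetSeries (f 2) θ' :=
      ext_derivCoeff fun σ => by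
        have := (hN' θ' hθ'N' hθ'E).2 2 (multiList σ)
        rw [prod_map_eq_prod_pow_count, jetD, count_multiList] at this
        simp only [fun i => congrFun (count_multiList σ) i] at this
        rw [derivCoeff_component, jetSeries, derivCoeff_taylor, ← this]
        simp [scaling]
    rwa [e0, e1, e2] at h1
  have hline : ∀ (θ' : Jet 4 3) (t : ℝ) (ψ : MvPowerSeries (Fin 4) ℝ),
      component 0 (θ' + t • variation 2 ψ) = component 0 θ' ∧
      component 1 (θ' + t • variation 2 ψ) = component 1 θ' ∧
      component 2 (θ' + t • variation 2 ψ) = component 2 θ' + t • ψ := by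
    intro θ' t ψ
    simp [component_add_smul_variation]
  set L : Set (MvPowerSeries (Fin 4) ℝ) := {ψ | transport i k l (p₁ V W) (p₂ V W) ψ = 0 ∧
    transport j k l (r₁ V W) (r₂ V W) ψ = 0} with hL
  -- The transport equations are linear in q and the condition on (v, w) does not involve q.
  have hEline : ∀ θ' ∈ E, component 0 θ' = V → component 1 θ' = W → ∀ ψ ∈ L, ∀ t : ℝ,
      θ' + t • variation 2 ψ ∈ E := by
    intro θ' hθ' h0 h1 ψ hψ t
    rw [hE] at hθ' ⊢
    obtain ⟨l0, l1, l2⟩ := hline θ' t ψ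
    rw [l0, l1, l2]
    rw [h0, h1] at hθ' ⊢
    refine ⟨hθ'.1, ?_, ?_⟩
    · rw [map_add, hθ'.2.1, Derivation.map_smul, hψ.1, smul_zero, add_zero]
    · rw [map_add, hθ'.2.2, Derivation.map_smul, hψ.2, smul_zero, add_zero]
  have hLφ : ∀ ψ ∈ L, φ * ψ ∈ L := by
    rintro ψ ⟨h1, h2⟩
    refine ⟨?_, ?_⟩
    · rw [Derivation.leibniz, h1, hφ₁, smul_zero, smul_zero, add_zero]
    · rw [Derivation.leibniz, h2, hφ₂, smul_zero, smul_zero, add_zero]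
  have h1L : (1 : MvPowerSeries (Fin 4) ℝ) ∈ L :=
    ⟨Derivation.map_one_eq_zero _, Derivation.map_one_eq_zero _⟩
  have hvert : ∀ θ' ∈ E ∩ N, component 0 θ' = V → component 1 θ' = W → ∀ l',
      lineDeriv ℝ (totalDs l' (f 2)) θ' (variation 2 1) = 0 := by
    intro θ' hθ' h0 h1 l'
    obtain ⟨T, hT, hTl⟩ := exists_linearization hf 2 θ'
    obtain ⟨K, hK⟩ := hT φ
    have hpt : ∀ ψ ∈ L, transport i k l (p₁' V W) (p₂' V W) (T ψ) = 0 ∧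
        transport j k l (r₁' V W) (r₂' V W) (T ψ) = 0 := by
      intro ψ hψ
      have hmem : ∀ᶠ t in 𝓝 (0 : ℝ), θ' + t • variation 2 ψ ∈ E ∩ N := by
        have h3 : (fun t : ℝ => θ' + t • variation 2 ψ) ⁻¹' N ∈ 𝓝 (0 : ℝ) :=
          (hNo.preimage (continuous_add_smul _ _)).mem_nhds (by simpa using hθ'.2)
        filter_upwards [h3] with t ht
        exact ⟨hEline θ' hθ'.1 h0 h1 ψ hψ t, ht⟩
      constructor
      · refine transport_linearization_eq_zero hf hTl ?_
        filter_upwards [hmem] with t ht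
        have := (hsol _ ht).1
        rwa [(hline θ' t ψ).1, (hline θ' t ψ).2.1, h0, h1] at this
      · refine transport_linearization_eq_zero hf hTl ?_
        filter_upwards [hmem] with t ht
        have := (hsol _ ht).2
        rwa [(hline θ' t ψ).1, (hline θ' t ψ).2.1, h0, h1] at this
    -- This is where φ enters: T maps L into the kernel of both changed derivations, and one of them
    -- does not kill φ.
    have hT0 : T 1 = 0 := by
      rcases hφ with hφ | hφ
      · exact eq_zero_of_adMul_nilpotent hLφ _ hφ T (fun ψ hψ => (hpt ψ hψ).1) K hK 1 h1L
      · exact eq_zero_of_adMul_nilpotent hLφ _ hφ T (fun ψ hψ => (hpt ψ hψ).2) K hK 1 h1L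
    rw [hTl, hT0, map_zero, map_zero]
  have hθE : ∀ t : ℝ, θ + t • variation 2 1 ∈ E := hEline θ hθ.1 hV.symm hW.symm 1 h1L
  obtain ⟨ε, hε, hball⟩ := Metric.mem_nhds_iff.1
    ((hNo.preimage (continuous_add_smul θ (variation 2 1))).mem_nhds
      (x := 0) (by simpa using ⟨hθN', hθ.2⟩))
  -- Adding a constant to q stays in E and does not alter (V, W), so `hvert` applies along the whole
  -- segment in N.
  have hconst : ∀ l', ∀ t ∈ Metric.ball (0 : ℝ) ε,
      totalDs l' (f 2) (θ + t • variation 2 1) = totalDs l' (f 2) θ := by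
    intro l' t ht
    have hd : ∀ t ∈ Metric.ball (0 : ℝ) ε,
        HasDerivAt (fun t : ℝ => totalDs l' (f 2) (θ + t • variation 2 1)) 0 t := by
      intro t ht
      have h1 := (hf.totalDs l').hasLineDerivAt (θ + t • variation 2 1) (variation 2 1)
      rw [hvert _ ⟨hθE t, hball ht⟩ ((hline _ _ _).1.trans hV.symm)
        ((hline _ _ _).2.1.trans hW.symm), HasLineDerivAt] at h1
      have h2 : HasDerivAt (fun t' : ℝ => totalDs l' (f 2)
          (θ + t • variation 2 1 + (t' - t) • variation 2 1)) 0 t := by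
        have := HasDerivAt.comp_sub_const (f := fun t' : ℝ => totalDs l' (f 2)
          (θ + t • variation 2 1 + t' • variation 2 1)) t t (by rwa [sub_self])
        exact this
      refine h2.congr_of_eventuallyEq (Filter.Eventually.of_forall fun t' => ?_)
      change _ = totalDs l' (f 2) (θ + t • variation 2 1 + (t' - t) • variation 2 1)
      rw [add_assoc, ← add_smul, add_sub_cancel]
    have h3 := Metric.isOpen_ball.is_const_of_deriv_eq_zero
      (convex_ball (0 : ℝ) ε).isPreconnected
      (fun t ht => (hd t ht).differentiableAt.differentiableWithinAt)
      (fun t ht => (hd t ht).deriv) ht (Metric.mem_ball_self hε)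
    simpa using h3
  have hmem : ε / 2 ∈ Metric.ball (0 : ℝ) ε := by
    rw [Metric.mem_ball, dist_zero_right, Real.norm_of_nonneg (by positivity)]
    linarith
  set θ' := θ + (ε / 2) • variation 2 1 with hθ'
  have hθ'N : θ' ∈ N := hball hmem
  -- The jets θ' and θ differ only in the value of q. The covering condition fixes the other
  -- coordinates of the image, and the Cartan relations express its q-derivatives through the total
  -- derivatives of `f 2`.
  have heq : Ψ θ' = Ψ θ := by
    have r1 := hN' θ' hθ'N.1 (hθE _)
    have r2 := hN' θ hθN' hθ.1
    have b1 := hcov θ' ⟨hθE _, hθ'N.2⟩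
    have b2 := hcov θ hθ
    have hforget : forgetLast θ' = forgetLast θ := by
      funext x
      rcases x with x | ⟨a, σ⟩
      · simp [hθ', forgetLast, variation]
      · have : a.castSucc ≠ (2 : Fin 3) := by
          rw [show (2 : Fin 3) = Fin.last 2 from rfl]; exact a.castSucc_ne_last
        simp [hθ', forgetLast, variation, this]
    rw [hforget, ← b2] at b1
    funext x
    rcases x with x | ⟨a, σ⟩
    · exact congrFun b1 (Sum.inl x)
    · refine Fin.lastCases ?_ (fun a => ?_) a
      · have q1 := r1.2 2 (multiList σ)
        have q2 := r2.2 2 (multiList σ)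
        rw [hconst _ _ hmem, ← q2, prod_map_eq_prod_pow_count] at q1
        have q3 := mul_left_cancel₀ (hprod _) q1
        rw [jetD, jetD, count_multiList] at q3
        exact q3
      · exact congrFun b1 (Sum.inr (a, σ))
  have heq' : θ' = θ := by
    rw [← hinv hθ, ← heq, hinv ⟨hθE _, hθ'N.2⟩]
  have := congrFun heq' (Sum.inr (2, 0))
  simp [hθ', variation, derivCoeff_zero] at this
  exact hε.ne' this

end Lifts

/-! ### Scalings and infinite prolongations -/

section Scaling

variable {n m : ℕ}

/-- A scaling is linear on jets and carries D_i to s_i D_i. -/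
lemma scaling_add_smul_cartanVec {s : Fin n → ℝ} (hs : ∀ i, s i ≠ 0) (c : Fin m → ℝ) (i : Fin n)
    (θ : Jet n m) (t : ℝ) : scaling s c (θ + t • cartanVec i θ)
      = scaling s c θ + t • s i • cartanVec i (scaling s c θ) := by
  funext x
  rcases x with j | ⟨a, σ⟩
  · by_cases h : j = i
    · subst h; simp [scaling, cartanVec]; ring
    · simp [scaling, cartanVec, h]
  · have h1 : ∏ j, s j ^ (σ j + (Pi.single i 1 : Fin n → ℕ) j) = (∏ j, s j ^ σ j) * s i := by
      simp only [pow_add, Finset.prod_mul_distrib]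
      congr 1
      rw [Finset.prod_eq_single i] <;> simp +contextual
    have h2 : (∏ j, s j ^ σ j) ≠ 0 := Finset.prod_ne_zero_iff.2 fun j _ => pow_ne_zero _ (hs j)
    have h3 := hs i
    simp only [scaling, cartanVec, Pi.add_apply, Pi.smul_apply, smul_eq_mul, h1]
    field_simp

lemma totalDs_comp_scaling {s : Fin n → ℝ} (hs : ∀ i, s i ≠ 0) (c : Fin m → ℝ)
    (f : Jet n m → ℝ) (l : List (Fin n)) :
    totalDs l (fun θ => f (scaling s c θ))
      = fun θ => (l.map s).prod * totalDs l f (scaling s c θ) := by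
  induction l with
  | nil => funext θ; simp [totalDs]
  | cons i l ih =>
    change totalD i (totalDs l _) = _
    rw [ih]
    funext θ
    rw [totalD, lineDeriv]
    simp only [scaling_add_smul_cartanVec hs]
    rw [deriv_const_mul_field]
    change _ * lineDeriv ℝ (totalDs l f) (scaling s c θ) (s i • cartanVec i (scaling s c θ)) = _
    rw [lineDeriv_smul, List.map_cons, List.prod_cons, smul_eq_mul, ← mul_assoc,
      mul_comm _ (s i)]
    rfl

lemma totalDs_const_mul (a : ℝ) (f : Jet n m → ℝ) (l : List (Fin n)) :
    totalDs l (fun θ => a * f θ) = fun θ => a * totalDs l f θ := by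
  induction l with
  | nil => rfl
  | cons i l ih =>
    change totalD i (totalDs l _) = _
    rw [ih]
    funext θ
    rw [totalD, lineDeriv, deriv_const_mul_field]
    rfl

/-- A scaling which multiplies the equations by constants preserves infinite prolongations. -/
lemma mapsTo_scaling_prolongation {ι : Type} {F F' : ι → Jet n m → ℝ} {s : Fin n → ℝ}
    (hs : ∀ i, s i ≠ 0) (c : Fin m → ℝ) (κ : ι → ℝ)
    (h : ∀ k θ, F' k (scaling s c θ) = κ k * F k θ) :
    Set.MapsTo (scaling s c) (prolongation F) (prolongation F') := by
  intro θ hθ k l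
  have h1 := congrFun (totalDs_comp_scaling hs c (F' k) l) θ
  simp only [h k, totalDs_const_mul] at h1
  rw [hθ k l, mul_zero] at h1
  refine (mul_eq_zero.1 h1.symm).resolve_left ?_
  rw [prod_map_eq_prod_pow_count]
  exact Finset.prod_ne_zero_iff.2 fun j _ => pow_ne_zero _ (hs j)

lemma jetD_scaling (s : Fin n → ℝ) (c : Fin m → ℝ) (a : Fin m) (l : List (Fin n))
    (θ : Jet n m) : jetD a l (scaling s c θ) = c a / (l.map s).prod * jetD a l θ := by
  rw [prod_map_eq_prod_pow_count]
  rfl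

lemma scaling_one : scaling (1 : Fin n → ℝ) (1 : Fin m → ℝ) = id := by
  funext θ x
  rcases x with j | ⟨a, σ⟩ <;> simp [scaling]

end Scaling

/-! ### Termwise computation of Taylor series -/

section HasJetSeries

open MvPowerSeries

variable {n m : ℕ} {f h : Jet n m → ℝ} {θ : Jet n m} {r r' : MvPowerSeries (Fin n) ℝ}

/-- `f` is a smooth jet function with the Taylor series `r` along `θ`. -/
def HasJetSeries (f : Jet n m → ℝ) (θ : Jet n m) (r : MvPowerSeries (Fin n) ℝ) : Prop :=
  IsSmoothJetFun f ∧ jetSeries f θ = r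

namespace HasJetSeries

lemma add (hf : HasJetSeries f θ r) (hh : HasJetSeries h θ r') :
    HasJetSeries (fun θ => f θ + h θ) θ (r + r') :=
  ⟨hf.1.add hh.1, by rw [jetSeries_add hf.1 hh.1, hf.2, hh.2]⟩

lemma sub (hf : HasJetSeries f θ r) (hh : HasJetSeries h θ r') :
    HasJetSeries (fun θ => f θ - h θ) θ (r - r') :=
  ⟨hf.1.sub hh.1, by rw [jetSeries_sub hf.1 hh.1, hf.2, hh.2]⟩

lemma mul (hf : HasJetSeries f θ r) (hh : HasJetSeries h θ r') :
    HasJetSeries (fun θ => f θ * h θ) θ (r * r') :=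
  ⟨hf.1.mul hh.1, by rw [jetSeries_mul hf.1 hh.1, hf.2, hh.2]⟩

lemma neg (hf : HasJetSeries f θ r) : HasJetSeries (fun θ => -f θ) θ (-r) :=
  ⟨hf.1.neg, by rw [jetSeries_neg hf.1, hf.2]⟩

lemma const (a : ℝ) (θ : Jet n m) : HasJetSeries (fun _ => a) θ (C a) :=
  ⟨.const a, jetSeries_const a θ⟩

lemma jetD (a : Fin m) (l : List (Fin n)) (θ : Jet n m) :
    HasJetSeries (fun θ => jetD a l θ) θ (pderivs l (component a θ)) :=
  ⟨isSmoothJetFun_jetD a l, jetSeries_jetD a l θ⟩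

end HasJetSeries

lemma mem_prolongation_iff_of_hasJetSeries {ι : Type} {F : ι → Jet n m → ℝ}
    {R : ι → Jet n m → MvPowerSeries (Fin n) ℝ} (hF : ∀ k θ, HasJetSeries (F k) θ (R k θ))
    (θ : Jet n m) : θ ∈ prolongation F ↔ ∀ k, R k θ = 0 := by
  rw [mem_prolongation_iff fun k => (hF k θ).1]
  exact forall_congr' fun k => by rw [(hF k θ).2]

end HasJetSeries

namespace Heavenly

open MvPowerSeries

lemma vec_z (a b c d : ℝ) : ![a, b, c, d] z = c := rfl

lemma vec_t (a b c d : ℝ) : ![a, b, c, d] t = d := rfl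

/-! ### The second heavenly equation -/

/-- The second heavenly equation on formal power series. -/
def IsSecondSolution (V W : MvPowerSeries (Fin 4) ℝ) : Prop :=
  pderiv ℝ t (pderiv ℝ y V) + pderiv ℝ x (pderiv ℝ z V) + pderiv ℝ y V * pderiv ℝ x (pderiv ℝ x V)
    - (pderiv ℝ x V + pderiv ℝ y W) * pderiv ℝ x (pderiv ℝ y V)
    + pderiv ℝ x W * pderiv ℝ y (pderiv ℝ y V) = 0 ∧
  pderiv ℝ t (pderiv ℝ y W) + pderiv ℝ x (pderiv ℝ z W) + pderiv ℝ y V * pderiv ℝ x (pderiv ℝ x W)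
    - (pderiv ℝ x V + pderiv ℝ y W) * pderiv ℝ x (pderiv ℝ y W)
    + pderiv ℝ x W * pderiv ℝ y (pderiv ℝ y W) = 0

lemma mem_joint_second_iff (lam : ℝ) (θ : Jet 4 3) : θ ∈ joint secondEq secondCov lam ↔
    IsSecondSolution (component 0 θ) (component 1 θ) ∧
    transport t x y (C lam - pderiv ℝ x (component 0 θ)) (pderiv ℝ x (component 1 θ))
      (component 2 θ) = 0 ∧
    transport z x y (pderiv ℝ y (component 0 θ)) (-(pderiv ℝ y (component 1 θ) + C lam))
      (component 2 θ) = 0 := by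
  let D (a : Fin 3) (l : List (Fin 4)) (θ : Jet 4 3) := pderivs l (component a θ)
  have J (a : Fin 3) (l : List (Fin 4)) (θ : Jet 4 3) := HasJetSeries.jetD a l θ
  rw [joint, mem_prolongation_iff_of_hasJetSeries (R := Sum.elim
    ![fun θ => D 0 [t, y] θ + D 0 [x, z] θ + D 0 [y] θ * D 0 [x, x] θ
        - (D 0 [x] θ + D 1 [y] θ) * D 0 [x, y] θ + D 1 [x] θ * D 0 [y, y] θ,
      fun θ => D 1 [t, y] θ + D 1 [x, z] θ + D 0 [y] θ * D 1 [x, x] θ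
        - (D 0 [x] θ + D 1 [y] θ) * D 1 [x, y] θ + D 1 [x] θ * D 1 [y, y] θ]
    ![fun θ => D 2 [t] θ - ((D 0 [x] θ - C lam) * D 2 [x] θ - D 1 [x] θ * D 2 [y] θ),
      fun θ => D 2 [z] θ - (- D 0 [y] θ * D 2 [x] θ + (D 1 [y] θ + C lam) * D 2 [y] θ)])]
  · simp only [Sum.forall, Fin.forall_fin_two, Sum.elim_inl, Sum.elim_inr, Matrix.cons_val_zero,
      Matrix.cons_val_one, D, pderivs_cons, pderivs_nil, IsSecondSolution, transport_apply]
    refine and_congr Iff.rfl (and_congr ?_ ?_) <;> refine Eq.congr_left ?_ <;> ring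
  · rintro (k | k) θ
    · refine Fin.cases ?_ (fun k => Fin.cases ?_ (fun k => k.elim0) k) k
      · exact ((((J 0 _ θ).add (J 0 _ θ)).add ((J 0 _ θ).mul (J 0 _ θ))).sub
          (((J 0 _ θ).add (J 1 _ θ)).mul (J 0 _ θ))).add ((J 1 _ θ).mul (J 0 _ θ))
      · exact ((((J 1 _ θ).add (J 1 _ θ)).add ((J 0 _ θ).mul (J 1 _ θ))).sub
          (((J 0 _ θ).add (J 1 _ θ)).mul (J 1 _ θ))).add ((J 1 _ θ).mul (J 1 _ θ))
    · refine Fin.cases ?_ (fun k => Fin.cases ?_ (fun k => k.elim0) k) k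
      · exact (J 2 _ θ).sub ((((J 0 _ θ).sub (.const lam θ)).mul (J 2 _ θ)).sub
          ((J 1 _ θ).mul (J 2 _ θ)))
      · exact (J 2 _ θ).sub (((J 0 _ θ).neg.mul (J 2 _ θ)).add
          (((J 1 _ θ).add (.const lam θ)).mul (J 2 _ θ)))

lemma mapsTo_scaling_second {a b d : ℝ} (ha : a ≠ 0) (hb : b ≠ 0) (hd : d ≠ 0) :
    Set.MapsTo (scaling ![a, b, d * b / a, d] ![a ^ 2 / d, a * b / d])
      (prolongation secondEq) (prolongation secondEq) := by
  refine mapsTo_scaling_prolongation ?_ _ ![a ^ 2 / d / (d * b), a * b / d / (d * b)] ?_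
  · intro i
    fin_cases i <;> simp [ha, hb, hd]
  · intro k θ
    fin_cases k <;> simp [secondEq, v, w, jetD_scaling, vec_z, vec_t] <;> field_simp

/-- With q kept fixed, comparing the weights 1/d of q_t and 1/a of λ q_x forces the new parameter to
be λ a / d. -/
lemma mapsTo_scaling_joint_second {a b d : ℝ} (ha : a ≠ 0) (hb : b ≠ 0) (hd : d ≠ 0) (lam : ℝ) :
    Set.MapsTo (scaling ![a, b, d * b / a, d] ![a ^ 2 / d, a * b / d, 1])
      (joint secondEq secondCov lam) (joint secondEq secondCov (lam * a / d)) := by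
  refine mapsTo_scaling_prolongation ?_ _ (Sum.elim ![a ^ 2 / d / (d * b), a * b / d / (d * b)]
    ![1 / d, a / (d * b)]) ?_
  · intro i
    fin_cases i <;> simp [ha, hb, hd]
  · have hv : ∀ l (θ : Jet 4 3), v l (forgetLast θ) = jetD 0 l θ := fun _ _ => rfl
    have hw : ∀ l (θ : Jet 4 3), w l (forgetLast θ) = jetD 1 l θ := fun _ _ => rfl
    rintro (k | k) θ
    · fin_cases k <;> simp [secondEq, hv, hw, jetD_scaling, vec_z, vec_t] <;> field_simp
    · fin_cases k <;> simp [secondCov, v', w', q, jetD_scaling, vec_z, vec_t] <;> field_simp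

/-- Formal integrals of the covering exist over every formal solution. -/
lemma exists_integral_second {V W : MvPowerSeries (Fin 4) ℝ} (h : IsSecondSolution V W)
    (lam : ℝ) : ∃ φ, transport t x y (C lam - pderiv ℝ x V) (pderiv ℝ x W) φ = 0 ∧
      transport z x y (pderiv ℝ y V) (-(pderiv ℝ y W + C lam)) φ = 0 ∧ pderiv ℝ x φ ≠ 0 := by
  -- The x- and y-components of the commutation condition are, up to sign, the two heavenly
  -- equations. The initial value x gives φ_x = 1 at the origin.
  obtain ⟨φ, h1, h2, f, g, hf, hg, rfl⟩ := exists_first_integral (i := t) (j := z) (k := x) (l := y)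
    (by decide) (by decide) (by decide) (by decide) (by decide)
    (C lam - pderiv ℝ x V) (pderiv ℝ x W) (pderiv ℝ y V) (-(pderiv ℝ y W + C lam))
    (by
      simp only [transport_apply, map_sub, pderiv_C]
      rw [pderiv_comm z x, pderiv_comm y x]
      linear_combination h.1)
    (by
      simp only [transport_apply, map_neg, map_add, pderiv_C]
      rw [pderiv_comm z x, pderiv_comm y x]
      linear_combination -h.2) (X x)
  refine ⟨_, h1, h2, fun h0 => ?_⟩
  have := congrArg constantCoeff h0
  rw [map_add, map_add, map_add, map_add, constantCoeff_pderiv_of_X_dvd (by decide) hf,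
    constantCoeff_pderiv_of_X_dvd (by decide) hg, pderiv_X_self] at this
  simp at this

/-- The inverse scaling pulls the parameter μ back to μ d / a. Taking a = b = d = 1 gives
non-removability, and μ = λ gives the statement on scaling symmetries. -/
theorem not_liftsLocally_second {a b d : ℝ} (ha : a ≠ 0) (hb : b ≠ 0) (hd : d ≠ 0) {lam mu : ℝ}
    (h : mu * d / a ≠ lam) :
    ¬ LiftsLocally ![a, b, d * b / a, d]
      (scaling ![a, b, d * b / a, d] ![a ^ 2 / d, a * b / d])
      (joint secondEq secondCov lam) (joint secondEq secondCov mu) := by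
  refine not_liftsLocally_scaling (B := IsSecondSolution) (p₁ := fun V _ => C lam - pderiv ℝ x V)
    (p₂ := fun _ W => pderiv ℝ x W) (r₁ := fun V _ => pderiv ℝ y V)
    (r₂ := fun _ W => -(pderiv ℝ y W + C lam)) ?_ ?_ (mem_joint_second_iff lam)
    (p₁' := fun V _ => C (mu * d / a) - pderiv ℝ x V) (p₂' := fun _ W => pderiv ℝ x W)
    (r₁' := fun V _ => pderiv ℝ y V) (r₂' := fun _ W => -(pderiv ℝ y W + C (mu * d / a)))
    ?_ ?_
  · intro i
    fin_cases i <;> simp [ha, hb, hd]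
  · intro i
    fin_cases i <;> simp [ha, hb, hd]
  · rintro θ hθ _ rfl
    have h1 := mapsTo_scaling_joint_second (inv_ne_zero ha) (inv_ne_zero hb) (inv_ne_zero hd) mu hθ
    have e1 : ![a⁻¹, b⁻¹, d⁻¹ * b⁻¹ / a⁻¹, d⁻¹] = (![a, b, d * b / a, d])⁻¹ := by
      funext i
      fin_cases i <;> simp
      field_simp
    have e2 : ![a⁻¹ ^ 2 / d⁻¹, a⁻¹ * b⁻¹ / d⁻¹, 1]
        = ![(![a ^ 2 / d, a * b / d] 0)⁻¹, (![a ^ 2 / d, a * b / d] 1)⁻¹, 1] := by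
      funext i
      fin_cases i <;> simp <;> field_simp
    have e3 : mu * a⁻¹ / d⁻¹ = mu * d / a := by field_simp
    rw [e1, e2, e3, mem_joint_second_iff] at h1
    exact h1.2
  · intro θ hθ U _ hθU
    obtain ⟨φ, h1, h2, h3⟩ := exists_integral_second ((mem_joint_second_iff lam θ).1 hθ).1 lam
    refine ⟨θ, ⟨hθ, hθU⟩, _, _, rfl, rfl, φ, h1, h2, Or.inl fun h4 => ?_⟩
    rw [transport_apply] at h1 h4
    -- The t-equations for the two parameters differ only in the coefficient of φ_x.
    have h5 : (C (mu * d / a) - C lam : MvPowerSeries (Fin 4) ℝ) * pderiv ℝ x φ = 0 := by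
      linear_combination h4 - h1
    rw [← map_sub] at h5
    rcases mul_eq_zero.1 h5 with h6 | h6
    · exact h (sub_eq_zero.1 (by simpa using congrArg constantCoeff h6))
    · exact h3 h6

end Heavenly

namespace Heavenly

open MvPowerSeries

/-! ### The first heavenly equation -/

/-- The first heavenly equation on formal power series. -/
def IsFirstSolution (V W : MvPowerSeries (Fin 4) ℝ) : Prop :=
  pderiv ℝ x V * pderiv ℝ t (pderiv ℝ y V) - pderiv ℝ y V * pderiv ℝ t (pderiv ℝ x V)
    + pderiv ℝ x W * pderiv ℝ y (pderiv ℝ z V) - pderiv ℝ y W * pderiv ℝ x (pderiv ℝ z V) = 0 ∧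
  pderiv ℝ x V * pderiv ℝ t (pderiv ℝ y W) - pderiv ℝ y V * pderiv ℝ t (pderiv ℝ x W)
    + pderiv ℝ x W * pderiv ℝ y (pderiv ℝ z W) - pderiv ℝ y W * pderiv ℝ x (pderiv ℝ z W) = 0

lemma mem_joint_first_iff (lam : ℝ) (θ : Jet 4 3) : θ ∈ joint firstEq firstCov lam ↔
    IsFirstSolution (component 0 θ) (component 1 θ) ∧
    transport x t z (C lam * pderiv ℝ x (component 0 θ)) (C lam * pderiv ℝ x (component 1 θ))
      (component 2 θ) = 0 ∧
    transport y t z (C lam * pderiv ℝ y (component 0 θ)) (C lam * pderiv ℝ y (component 1 θ))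
      (component 2 θ) = 0 := by
  let D (a : Fin 3) (l : List (Fin 4)) (θ : Jet 4 3) := pderivs l (component a θ)
  have J (a : Fin 3) (l : List (Fin 4)) (θ : Jet 4 3) := HasJetSeries.jetD a l θ
  rw [joint, mem_prolongation_iff_of_hasJetSeries (R := Sum.elim
    ![fun θ => D 0 [x] θ * D 0 [t, y] θ - D 0 [y] θ * D 0 [t, x] θ
        + D 1 [x] θ * D 0 [y, z] θ - D 1 [y] θ * D 0 [x, z] θ,
      fun θ => D 0 [x] θ * D 1 [t, y] θ - D 0 [y] θ * D 1 [t, x] θ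
        + D 1 [x] θ * D 1 [y, z] θ - D 1 [y] θ * D 1 [x, z] θ]
    ![fun θ => D 2 [x] θ - (C (-lam) * (D 0 [x] θ * D 2 [t] θ + D 1 [x] θ * D 2 [z] θ)),
      fun θ => D 2 [y] θ - (C (-lam) * (D 0 [y] θ * D 2 [t] θ + D 1 [y] θ * D 2 [z] θ))])]
  · simp only [Sum.forall, Fin.forall_fin_two, Sum.elim_inl, Sum.elim_inr, Matrix.cons_val_zero,
      Matrix.cons_val_one, D, pderivs_cons, pderivs_nil, IsFirstSolution, transport_apply, map_neg]
    refine and_congr Iff.rfl (and_congr ?_ ?_) <;> refine Eq.congr_left ?_ <;> ring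
  · rintro (k | k) θ
    · refine Fin.cases ?_ (fun k => Fin.cases ?_ (fun k => k.elim0) k) k
      · exact ((((J 0 _ θ).mul (J 0 _ θ)).sub ((J 0 _ θ).mul (J 0 _ θ))).add
          ((J 1 _ θ).mul (J 0 _ θ))).sub ((J 1 _ θ).mul (J 0 _ θ))
      · exact ((((J 0 _ θ).mul (J 1 _ θ)).sub ((J 0 _ θ).mul (J 1 _ θ))).add
          ((J 1 _ θ).mul (J 1 _ θ))).sub ((J 1 _ θ).mul (J 1 _ θ))
    · refine Fin.cases ?_ (fun k => Fin.cases ?_ (fun k => k.elim0) k) k <;>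
        exact (J 2 _ θ).sub ((HasJetSeries.const (-lam) θ).mul
          (((J 0 _ θ).mul (J 2 _ θ)).add ((J 1 _ θ).mul (J 2 _ θ))))

lemma mapsTo_scaling_first {a b e d c : ℝ} (ha : a ≠ 0) (hb : b ≠ 0) (he : e ≠ 0) (hd : d ≠ 0) :
    Set.MapsTo (scaling ![a, b, e, d] ![c, c * e / d])
      (prolongation firstEq) (prolongation firstEq) := by
  refine mapsTo_scaling_prolongation ?_ _ ![c ^ 2 / (a * b * d), c ^ 2 * e / (a * b * d ^ 2)] ?_
  · intro i
    fin_cases i <;> simp [ha, hb, he, hd]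
  · intro k θ
    fin_cases k <;> simp [firstEq, v, w, jetD_scaling, vec_z, vec_t] <;> field_simp

lemma mapsTo_scaling_joint_first {a b e d c : ℝ} (ha : a ≠ 0) (hb : b ≠ 0) (he : e ≠ 0)
    (hd : d ≠ 0) (hc : c ≠ 0) (lam : ℝ) :
    Set.MapsTo (scaling ![a, b, e, d] ![c, c * e / d, 1])
      (joint firstEq firstCov lam) (joint firstEq firstCov (lam * d / c)) := by
  refine mapsTo_scaling_prolongation ?_ _
    (Sum.elim ![c ^ 2 / (a * b * d), c ^ 2 * e / (a * b * d ^ 2)] ![1 / a, 1 / b]) ?_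
  · intro i
    fin_cases i <;> simp [ha, hb, he, hd]
  · have hv : ∀ l (θ : Jet 4 3), v l (forgetLast θ) = jetD 0 l θ := fun _ _ => rfl
    have hw : ∀ l (θ : Jet 4 3), w l (forgetLast θ) = jetD 1 l θ := fun _ _ => rfl
    rintro (k | k) θ
    · fin_cases k <;> simp [firstEq, hv, hw, jetD_scaling, vec_z, vec_t] <;> field_simp
    · fin_cases k <;> simp [firstCov, v', w', q, jetD_scaling, vec_z, vec_t] <;> field_simp

/-- In the commutator of the two derivations the terms linear in λ cancel by symmetry of mixed
derivatives; what remains is λ² times the heavenly equations. -/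
lemma exists_integral_first_aux {V W : MvPowerSeries (Fin 4) ℝ} (h : IsFirstSolution V W)
    (lam : ℝ) (k : Fin 4) : ∃ φ,
      transport x t z (C lam * pderiv ℝ x V) (C lam * pderiv ℝ x W) φ = 0 ∧
      transport y t z (C lam * pderiv ℝ y V) (C lam * pderiv ℝ y W) φ = 0 ∧
      ∀ i, i ≠ x → i ≠ y → constantCoeff (pderiv ℝ i φ) = if i = k then 1 else 0 := by
  obtain ⟨φ, h1, h2, f, g, hf, hg, rfl⟩ := exists_first_integral (i := x) (j := y) (k := t) (l := z)
    (by decide) (by decide) (by decide) (by decide) (by decide)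
    (C lam * pderiv ℝ x V) (C lam * pderiv ℝ x W) (C lam * pderiv ℝ y V) (C lam * pderiv ℝ y W)
    (by
      simp only [transport_apply, Derivation.leibniz, pderiv_C, smul_eq_mul]
      have h1 := h.1
      rw [pderiv_comm y z, pderiv_comm x z] at h1
      rw [pderiv_comm x y]
      linear_combination C lam ^ 2 * h1)
    (by
      simp only [transport_apply, Derivation.leibniz, pderiv_C, smul_eq_mul]
      have h2 := h.2
      rw [pderiv_comm y z, pderiv_comm x z] at h2
      rw [pderiv_comm x y]
      linear_combination C lam ^ 2 * h2) (X k)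
  refine ⟨_, h1, h2, fun i hix hiy => ?_⟩
  rw [map_add, map_add, map_add, map_add, constantCoeff_pderiv_of_X_dvd hix hf,
    constantCoeff_pderiv_of_X_dvd hiy hg, add_zero, add_zero]
  by_cases hik : i = k
  · rw [hik, pderiv_X_self, if_pos rfl, map_one]
  · rw [pderiv_X_of_ne (Ne.symm hik), if_neg hik, map_zero]

/-- Formal integrals of the covering separate directions in the `(t, z)`-plane. -/
lemma exists_integral_first {V W : MvPowerSeries (Fin 4) ℝ} (h : IsFirstSolution V W)
    (lam : ℝ) {α β : MvPowerSeries (Fin 4) ℝ} (hαβ : α ≠ 0 ∨ β ≠ 0) : ∃ φ,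
      transport x t z (C lam * pderiv ℝ x V) (C lam * pderiv ℝ x W) φ = 0 ∧
      transport y t z (C lam * pderiv ℝ y V) (C lam * pderiv ℝ y W) φ = 0 ∧
      α * pderiv ℝ t φ + β * pderiv ℝ z φ ≠ 0 := by
  obtain ⟨T, hT1, hT2, hT⟩ := exists_integral_first_aux h lam t
  obtain ⟨Z, hZ1, hZ2, hZ⟩ := exists_integral_first_aux h lam z
  by_contra hcon
  push Not at hcon
  have h1 := hcon T hT1 hT2
  have h2 := hcon Z hZ1 hZ2
  -- The integrals T and Z have the first-order data of t and z, so this determinant has constant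
  -- term 1, and by Cramer's rule a direction (α, β) killing both is zero.
  have hdet : pderiv ℝ t T * pderiv ℝ z Z - pderiv ℝ z T * pderiv ℝ t Z ≠ 0 := by
    intro h0
    have := congrArg constantCoeff h0
    rw [map_sub, map_mul, map_mul, hT t (by decide) (by decide), hT z (by decide) (by decide),
      hZ t (by decide) (by decide), hZ z (by decide) (by decide), if_pos rfl, if_pos rfl,
      if_neg (by decide), if_neg (by decide)] at this
    simp at this
  rcases hαβ with h0 | h0
  · refine mul_ne_zero h0 hdet ?_
    linear_combination pderiv ℝ z Z * h1 - pderiv ℝ z T * h2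
  · refine mul_ne_zero h0 hdet ?_
    linear_combination pderiv ℝ t T * h2 - pderiv ℝ t Z * h1

/-- For a jet `θ` of a solution with `v`, `w`, `q` depending on `(z, t)` only, the jet of the
solution `v + ε x`, `w`, `q(z, t - λ ε x)`. -/
def tilt (lam : ℝ) (θ : Jet 4 3) (ε : ℝ) : Jet 4 3
  | Sum.inl i => θ (Sum.inl i)
  | Sum.inr (a, σ) =>
    if a = 2 then
      if σ y = 0 then (-(lam * ε)) ^ σ x * θ (Sum.inr (2, ![0, 0, σ z, σ t + σ x])) else 0
    else θ (Sum.inr (a, σ)) + if a = 0 ∧ σ = Pi.single x 1 then ε else 0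

lemma continuous_tilt (lam : ℝ) (θ : Jet 4 3) : Continuous (tilt lam θ) := by
  refine continuous_pi fun c => ?_
  rcases c with i | ⟨a, σ⟩
  · exact continuous_const
  · simp only [tilt]
    split_ifs <;> fun_prop

lemma derivCoeff_X {n : ℕ} (σ : Fin n → ℕ) (i : Fin n) :
    derivCoeff σ (X i : MvPowerSeries (Fin n) ℝ) = if σ = Pi.single i 1 then 1 else 0 := by
  have h1 : Finsupp.equivFunOnFinite.symm σ = Finsupp.single i 1 ↔ σ = Pi.single i 1 := by
    rw [Equiv.symm_apply_eq, Finsupp.equivFunOnFinite_single]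
  rw [derivCoeff, coeff_X]
  by_cases h : σ = Pi.single i 1
  · rw [if_pos (h1.2 h), if_pos h, mul_one]
    subst h
    refine Finset.prod_eq_one fun j _ => ?_
    by_cases hj : j = i
    · subst hj; simp
    · simp [hj]
  · rw [if_neg (fun h' => h (h1.1 h')), if_neg h, mul_zero]

lemma component_zero_tilt (lam : ℝ) (θ : Jet 4 3) (ε : ℝ) :
    component 0 (tilt lam θ ε) = component 0 θ + ε • X x :=
  ext_derivCoeff fun σ => by
    rw [derivCoeff_component, derivCoeff_add, derivCoeff_smul, derivCoeff_component, derivCoeff_X]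
    simp [tilt]

lemma component_one_tilt (lam : ℝ) (θ : Jet 4 3) (ε : ℝ) :
    component 1 (tilt lam θ ε) = component 1 θ :=
  ext_derivCoeff fun σ => by
    rw [derivCoeff_component, derivCoeff_component]
    simp [tilt]

/-- On functions of z and t - λ ε x, an x-derivative is a t-derivative times -λ ε. -/
lemma pderiv_x_component_two_tilt (lam : ℝ) (θ : Jet 4 3) (ε : ℝ) :
    pderiv ℝ x (component 2 (tilt lam θ ε))
      = -(lam * ε) • pderiv ℝ t (component 2 (tilt lam θ ε)) :=
  ext_derivCoeff fun σ => by
    rw [derivCoeff_smul, derivCoeff_pderiv, derivCoeff_pderiv, derivCoeff_component,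
      derivCoeff_component]
    simp only [tilt, if_true]
    have s₁ : (Pi.single t 1 : Fin 4 → ℕ) x = 0 ∧ (Pi.single t 1 : Fin 4 → ℕ) y = 0 ∧
        (Pi.single t 1 : Fin 4 → ℕ) z = 0 := ⟨rfl, rfl, rfl⟩
    have s₂ : (Pi.single x 1 : Fin 4 → ℕ) t = 0 ∧ (Pi.single x 1 : Fin 4 → ℕ) y = 0 ∧
        (Pi.single x 1 : Fin 4 → ℕ) z = 0 := ⟨rfl, rfl, rfl⟩
    simp only [Pi.add_apply, Pi.single_eq_same, s₁, s₂, add_zero]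
    by_cases h : σ y = 0
    · rw [if_pos h, if_pos h, add_right_comm (σ t) 1, add_assoc (σ t), pow_succ]
      ring
    · rw [if_neg h, if_neg h, mul_zero]

lemma pderiv_y_component_two_tilt (lam : ℝ) (θ : Jet 4 3) (ε : ℝ) :
    pderiv ℝ y (component 2 (tilt lam θ ε)) = 0 :=
  ext_derivCoeff fun σ => by
    rw [derivCoeff_zero_right, derivCoeff_pderiv, derivCoeff_component]
    simp [tilt]

lemma tilt_zero {lam : ℝ} {θ : Jet 4 3} (hx : pderiv ℝ x (component 2 θ) = 0)
    (hy : pderiv ℝ y (component 2 θ) = 0) : tilt lam θ 0 = θ := by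
  -- At ε = 0 the tilted jet retains only the q-derivatives without x and y, so the others must
  -- already vanish.
  have key : ∀ i, pderiv ℝ i (component 2 θ) = 0 → ∀ σ : Fin 4 → ℕ, σ i ≠ 0 →
      θ (Sum.inr (2, σ)) = 0 := by
    intro i hi σ hσ
    have h1 : σ - Pi.single i 1 + Pi.single i 1 = σ := by
      refine tsub_add_cancel_of_le fun j => ?_
      by_cases hj : j = i
      · subst hj; simpa using Nat.one_le_iff_ne_zero.2 hσ
      · simp [hj]
    have h2 := derivCoeff_pderiv (σ - Pi.single i 1) i (component 2 θ)
    rw [hi, derivCoeff_zero_right, h1, derivCoeff_component] at h2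
    exact h2.symm
  funext c
  rcases c with i | ⟨a, σ⟩
  · rfl
  · by_cases ha : a = 2
    · subst ha
      simp only [tilt, if_true]
      by_cases h1 : σ y = 0
      · by_cases h0 : σ x = 0
        · have : ![0, 0, σ z, σ t + σ x] = σ := by
            funext i
            fin_cases i
            · exact h0.symm
            · exact h1.symm
            · rfl
            · change σ t + σ x = σ t
              rw [h0, add_zero]
          rw [this, if_pos h1, h0, pow_zero, one_mul]
        · simp [h0, h1, key x hx σ h0]
      · rw [if_neg h1, key y hy σ h1]
    · simp [tilt, ha]

lemma tilt_mem_joint {lam : ℝ} {θ : Jet 4 3} (hV₁ : pderiv ℝ x (component 0 θ) = 0)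
    (hV₂ : pderiv ℝ y (component 0 θ) = 0) (hW₁ : pderiv ℝ x (component 1 θ) = 0)
    (hW₂ : pderiv ℝ y (component 1 θ) = 0) (ε : ℝ) :
    tilt lam θ ε ∈ joint firstEq firstCov lam := by
  have hx : pderiv ℝ x (component 0 (tilt lam θ ε)) = C ε := by
    rw [component_zero_tilt, map_add, hV₁, Derivation.map_smul, pderiv_X_self, zero_add,
      smul_eq_C_mul, mul_one]
  have hy : pderiv ℝ y (component 0 (tilt lam θ ε)) = 0 := by
    rw [component_zero_tilt, map_add, hV₂, Derivation.map_smul, pderiv_X_of_ne (by decide),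
      smul_zero, zero_add]
  rw [mem_joint_first_iff, IsFirstSolution, component_one_tilt, hx, hy, hW₁, hW₂]
  refine ⟨⟨by simp, by simp⟩, ?_, ?_⟩
  · rw [transport_apply, pderiv_x_component_two_tilt, smul_eq_C_mul, map_neg, map_mul]
    ring
  · rw [transport_apply, pderiv_y_component_two_tilt]
    simp

theorem not_liftsLocally_first {a b e d c : ℝ} (ha : a ≠ 0) (hb : b ≠ 0) (he : e ≠ 0)
    (hd : d ≠ 0) (hc : c ≠ 0) {lam mu : ℝ} (h : mu * c / d ≠ lam) :
    ¬ LiftsLocally ![a, b, e, d] (scaling ![a, b, e, d] ![c, c * e / d])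
      (joint firstEq firstCov lam) (joint firstEq firstCov mu) := by
  refine not_liftsLocally_scaling (B := IsFirstSolution) (p₁ := fun V _ => C lam * pderiv ℝ x V)
    (p₂ := fun _ W => C lam * pderiv ℝ x W) (r₁ := fun V _ => C lam * pderiv ℝ y V)
    (r₂ := fun _ W => C lam * pderiv ℝ y W) ?_ ?_ (mem_joint_first_iff lam)
    (p₁' := fun V _ => C (mu * c / d) * pderiv ℝ x V)
    (p₂' := fun _ W => C (mu * c / d) * pderiv ℝ x W)
    (r₁' := fun V _ => C (mu * c / d) * pderiv ℝ y V)
    (r₂' := fun _ W => C (mu * c / d) * pderiv ℝ y W) ?_ ?_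
  · intro i
    fin_cases i <;> simp [ha, hb, he, hd]
  · intro i
    fin_cases i <;> simp [hc, he, hd]
  · rintro θ hθ _ rfl
    have h1 := mapsTo_scaling_joint_first (inv_ne_zero ha) (inv_ne_zero hb) (inv_ne_zero he)
      (inv_ne_zero hd) (inv_ne_zero hc) mu hθ
    have e1 : ![a⁻¹, b⁻¹, e⁻¹, d⁻¹] = (![a, b, e, d])⁻¹ := by
      funext i
      fin_cases i <;> simp
    have e2 : ![c⁻¹, c⁻¹ * e⁻¹ / d⁻¹, 1]
        = ![(![c, c * e / d] 0)⁻¹, (![c, c * e / d] 1)⁻¹, 1] := by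
      funext i
      fin_cases i <;> simp
      field_simp
    have e3 : mu * d⁻¹ / c⁻¹ = mu * c / d := by field_simp
    rw [e1, e2, e3, mem_joint_first_iff] at h1
    exact h1.2
  · have hreg : ∀ θ ∈ joint firstEq firstCov lam,
        pderiv ℝ x (component 0 θ) ≠ 0 ∨ pderiv ℝ x (component 1 θ) ≠ 0 ∨
          pderiv ℝ y (component 0 θ) ≠ 0 ∨ pderiv ℝ y (component 1 θ) ≠ 0 →
        ∃ φ, transport x t z (C lam * pderiv ℝ x (component 0 θ))
            (C lam * pderiv ℝ x (component 1 θ)) φ = 0 ∧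
          transport y t z (C lam * pderiv ℝ y (component 0 θ))
            (C lam * pderiv ℝ y (component 1 θ)) φ = 0 ∧
          (transport x t z (C (mu * c / d) * pderiv ℝ x (component 0 θ))
            (C (mu * c / d) * pderiv ℝ x (component 1 θ)) φ ≠ 0 ∨
          transport y t z (C (mu * c / d) * pderiv ℝ y (component 0 θ))
            (C (mu * c / d) * pderiv ℝ y (component 1 θ)) φ ≠ 0) := by
      intro θ hθ hne
      have hsol := ((mem_joint_first_iff lam θ).1 hθ).1
      have hC : (C (mu * c / d) - C lam : MvPowerSeries (Fin 4) ℝ) ≠ 0 := by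
        rw [← map_sub]
        exact fun h0 => h (sub_eq_zero.1 (by simpa using congrArg constantCoeff h0))
      rw [← or_assoc] at hne
      rcases hne with hne | hne
      · obtain ⟨φ, h1, h2, h3⟩ := exists_integral_first hsol lam hne
        refine ⟨φ, h1, h2, Or.inl fun h4 => mul_ne_zero hC h3 ?_⟩
        rw [transport_apply] at h1 h4
        linear_combination h4 - h1
      · obtain ⟨φ, h1, h2, h3⟩ := exists_integral_first hsol lam hne
        refine ⟨φ, h1, h2, Or.inr fun h4 => mul_ne_zero hC h3 ?_⟩
        rw [transport_apply] at h2 h4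
        linear_combination h4 - h2
    intro θ hθ U hU hθU
    -- If all four derivatives vanish, the covering reads q_x = q_y = 0 for every parameter and no φ
    -- separates two of them. Tilting by a small ε stays in U by continuity and gives V_x = ε.
    by_cases hne : pderiv ℝ x (component 0 θ) ≠ 0 ∨ pderiv ℝ x (component 1 θ) ≠ 0 ∨
          pderiv ℝ y (component 0 θ) ≠ 0 ∨ pderiv ℝ y (component 1 θ) ≠ 0
    · exact ⟨θ, ⟨hθ, hθU⟩, _, _, rfl, rfl, hreg θ hθ hne⟩
    · push Not at hne
      obtain ⟨hV₁, hW₁, hV₂, hW₂⟩ := hne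
      obtain ⟨-, hq₁, hq₂⟩ := (mem_joint_first_iff lam θ).1 hθ
      rw [transport_apply, hV₁, hW₁, mul_zero, zero_mul, zero_mul, add_zero, add_zero] at hq₁
      rw [transport_apply, hV₂, hW₂, mul_zero, zero_mul, zero_mul, add_zero, add_zero] at hq₂
      obtain ⟨r, hr, hball⟩ := Metric.mem_nhds_iff.1
        ((hU.preimage (continuous_tilt lam θ)).mem_nhds (x := 0)
          (by simpa [tilt_zero hq₁ hq₂] using hθU))
      have hmem : r / 2 ∈ Metric.ball (0 : ℝ) r := by
        rw [Metric.mem_ball, dist_zero_right, Real.norm_of_nonneg (by positivity)]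
        linarith
      have hE := tilt_mem_joint (lam := lam) hV₁ hV₂ hW₁ hW₂ (r / 2)
      refine ⟨tilt lam θ (r / 2), ⟨hE, hball hmem⟩, _, _, rfl, rfl, hreg _ hE (Or.inl ?_)⟩
      rw [component_zero_tilt, map_add, hV₁, Derivation.map_smul, pderiv_X_self, zero_add]
      intro h0
      have := congrArg constantCoeff h0
      simp at this
      exact hr.ne' this

end Heavenly

/-! ### Assembly of the main theorem -/

theorem mainTheorem9 :
    -- the second heavenly equation
    (IsNonremovable (Heavenly.joint Heavenly.secondEq Heavenly.secondCov) ∧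
      ∀ a b d : ℝ, a ≠ 0 → b ≠ 0 → d ≠ 0 →
        Set.MapsTo (scaling ![a, b, d * b / a, d] ![a ^ 2 / d, a * b / d])
          (prolongation Heavenly.secondEq) (prolongation Heavenly.secondEq) ∧
        ∀ lam : ℝ, lam ≠ 0 → a ≠ d →
          ¬ LiftsLocally ![a, b, d * b / a, d]
            (scaling ![a, b, d * b / a, d] ![a ^ 2 / d, a * b / d])
            (Heavenly.joint Heavenly.secondEq Heavenly.secondCov lam)
            (Heavenly.joint Heavenly.secondEq Heavenly.secondCov lam)) ∧
    -- the first heavenly equation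
    (IsNonremovable (Heavenly.joint Heavenly.firstEq Heavenly.firstCov) ∧
      ∀ a b e d c : ℝ, a ≠ 0 → b ≠ 0 → e ≠ 0 → d ≠ 0 → c ≠ 0 →
        Set.MapsTo (scaling ![a, b, e, d] ![c, c * e / d])
          (prolongation Heavenly.firstEq) (prolongation Heavenly.firstEq) ∧
        ∀ lam : ℝ, lam ≠ 0 → c ≠ d →
          ¬ LiftsLocally ![a, b, e, d]
            (scaling ![a, b, e, d] ![c, c * e / d])
            (Heavenly.joint Heavenly.firstEq Heavenly.firstCov lam)
            (Heavenly.joint Heavenly.firstEq Heavenly.firstCov lam)) := by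
  have ones₂ : ![(1 : ℝ), 1] = 1 := by funext i; fin_cases i <;> rfl
  have ones₄ : ![(1 : ℝ), 1, 1, 1] = 1 := by funext i; fin_cases i <;> rfl
  refine ⟨⟨fun lam mu h hlift => ?_, fun a b d ha hb hd =>
    ⟨Heavenly.mapsTo_scaling_second ha hb hd, fun lam hlam had =>
      Heavenly.not_liftsLocally_second ha hb hd fun h => had ?_⟩⟩,
    ⟨fun lam mu h hlift => ?_, fun a b e d c ha hb he hd hc =>
    ⟨Heavenly.mapsTo_scaling_first ha hb he hd, fun lam hlam hcd =>
      Heavenly.not_liftsLocally_first ha hb he hd hc fun h => hcd ?_⟩⟩⟩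
  · refine Heavenly.not_liftsLocally_second (a := 1) (b := 1) (d := 1) one_ne_zero one_ne_zero
      one_ne_zero (lam := lam) (mu := mu) (by simpa using h.symm) ?_
    simp only [one_pow, mul_one, div_one]
    rw [ones₄, ones₂, scaling_one]
    exact hlift
  -- An unchanged parameter, λ d / a = λ with λ ≠ 0, would force a = d.
  · rw [div_eq_iff ha] at h
    exact (mul_left_cancel₀ hlam h).symm
  · refine Heavenly.not_liftsLocally_first (a := 1) (b := 1) (e := 1) (d := 1) (c := 1) one_ne_zero
      one_ne_zero one_ne_zero one_ne_zero one_ne_zero (lam := lam) (mu := mu)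
      (by simpa using h.symm) ?_
    simp only [mul_one, div_one]
    rw [ones₄, ones₂, scaling_one]
    exact hlift
  · rw [div_eq_iff hd] at h
    exact mul_left_cancel₀ hlam h
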